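/- Let $X\subset S^{n-1}\subset\mathbb R^n$ be a finite nonempty antipodal set ($-x\in X$ for all $x\in X$) which is a spherical $t$-design (every real polynomial of degree at most $t$ has the same average over $X$ and over $S^{n-1}$), let $A(X)=\{x\cdot y : x,y\in X,\ x\ne y\}$ and $s=|A(X)|$, and assume $t\ge 2s-3$. Then the relations $\{(x,y)\in X\times X : x\cdot y=\alpha\}$, $\alpha\in A(X)\cup\{1\}$, form a symmetric association scheme of class $s$ on $X$. Moreover, its adjacency matrices $D_0=I,D_1,\dots,D_s$ and the primitive idempotents $E_0=\frac1{|X|}J,E_1,\dots,E_s$ of its Bose–Mesner algebra can be ordered such that the following hold, where the eigenmatrices $P_j(i)$, $Q_j(i)$ and the Krein numbers $q_{i,j}^k$ are defined by $D_j=\sum_i P_j(i)E_i$, $|X|E_j=\sum_i Q_j(i)D_i$ and $|X|E_i\circ|X|E_j=\sum_k q_{i,j}^k|X|E_k$ (with $\circ$ the entrywise product), $m_i=\operatorname{rank}E_i$, and $\binom ak=0$ for $k<0$. 1. $P_1(i)=(-1)^i$ for $0\le i\le s$. 2. $Q_j(2i+1)=(-1)^jQ_j(2i)$ for $1\le 2i+1\le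 s$ and $0\le j\le s$. If $s$ is even, then $Q_j(s)=0$ for every odd $j$ with $1\le j\le s-1$. 3. $m_i=Q_i(0)$ for $0\le i\le s$; $m_i=\binom{n+i-1}{i}-\binom{n+i-3}{i-2}$ for $0\le i\le s-2$; $m_{s-1}=\frac{|X|}2-\binom{n+s-4}{s-3}$; and $m_s=\frac{|X|}2-\binom{n+s-3}{s-2}$. 4. $q_{\mu,i}^j=0$ whenever $0\le\mu,i,j\le s$ and $\mu+i+j$ is odd. 5. The scheme is Q-polynomial with respect to this ordering: for each $0\le i\le s$ there is a polynomial $v_i$ of degree $i$ such that $|X|E_i$ is obtained by applying $v_i$ to every entry of $|X|E_1$. The dual intersection matrix $B_1^*=(q_{1,i}^j)_{0\le i,j\le s}$ is tridiagonal with zero diagonal. If $s\ge3$, or if $s=2$ and $t\ge2$, its nonzero entries are - $q_{1,1}^0=n$ and $q_{1,s-1}^s=n$; - $c_i^*=q_{1,i-1}^i=\frac{ni}{n+2i-2}$ for $1\le i\le s-2$; - $b_i^*=q_{1,i+1}^i=\frac{n(n+i-2)}{n+2i-2}$ for $1\le i\le s-2$; - $c_{s-1}^*=q_{1,s-2}^{s-1}=\frac{2n(n-1)(n+s-4)!}{(s-2)!\,(n-1)!\,|X|-2(s-2)(n+s-4)!}$;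 - $b_{s-1}^*=q_{1,s}^{s-1}=\frac{(s-2)!\,n!\,|X|-2n(n+s-3)!}{(s-2)!\,(n-1)!\,|X|-2(s-2)(n+s-4)!}$. -/

import Mathlib

open scoped Matrix Nat

noncomputable section

/-- A finite nonempty subset `X` of the unit sphere of `ℝⁿ` is a spherical `t`-design if every real
polynomial of degree at most `t` has the same average over `X` and over the sphere
(with respect to the surface measure). -/
def IsSphericalDesign {n : ℕ} (t : ℕ) (X : Finset (EuclideanSpace ℝ (Fin n))) : Prop :=
  X.Nonempty ∧ (∀ x ∈ X, ‖x‖ = 1) ∧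
    ∀ p : MvPolynomial (Fin n) ℝ, p.totalDegree ≤ t →
      (∑ x ∈ X, MvPolynomial.eval (fun k => x k) p) / (X.card : ℝ) =
        ⨍ u : Metric.sphere (0 : EuclideanSpace ℝ (Fin n)) 1,
          MvPolynomial.eval (fun k => (u : EuclideanSpace ℝ (Fin n)) k) p
            ∂((MeasureTheory.volume : MeasureTheory.Measure (EuclideanSpace ℝ (Fin n))).toSphere)

/-- `A(X)`: the inner products of two distinct elements of `X`. On the unit sphere these correspond
bijectively to the distances between distinct elements, so that `X` is an `s`-distance set when
`A(X)` has `s` elements. -/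
def innerProducts {n : ℕ} (X : Finset (EuclideanSpace ℝ (Fin n))) : Set ℝ :=
  {a | ∃ x ∈ X, ∃ y ∈ X, x ≠ y ∧ inner ℝ x y = a}

/-- A (symmetric) association scheme of class `d` on the finite set `V`, with its relations
`R_0, …, R_d` in a fixed order. -/
structure AssociationScheme (V : Type*) [Fintype V] (d : ℕ) where
  /-- the relations `R_i` -/
  rel : Fin (d + 1) → V → V → Prop
  /-- `R_0` is the diagonal -/
  rel_zero : ∀ x y, rel 0 x y ↔ x = y
  /-- the relations partition `V × V` -/
  existsUnique_rel : ∀ x y, ∃! i, rel i x y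
  /-- all the relations are nonempty -/
  rel_nonempty : ∀ i, ∃ x y, rel i x y
  /-- all the relations are symmetric -/
  rel_symm : ∀ i x y, rel i x y → rel i y x
  /-- the intersection numbers `p_{i,j}^k` exist -/
  exists_intersectionNumber : ∀ i j k, ∃ p : ℕ, ∀ x y, rel k x y →
    Nat.card {z : V // rel i x z ∧ rel j z y} = p

namespace AssociationScheme

variable {V : Type*} [Fintype V] {d : ℕ} (S : AssociationScheme V d)

open scoped Classical in
/-- The adjacency matrix `D_i` of the relation `R_i`. -/
def adj (i : Fin (d + 1)) : Matrix V V ℝ :=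
  Matrix.of fun x y => if S.rel i x y then 1 else 0

/-- The Bose-Mesner algebra, that is, the real span of the adjacency matrices. -/
def boseMesner : Submodule ℝ (Matrix V V ℝ) :=
  Submodule.span ℝ (Set.range S.adj)

/-- `e` is a primitive idempotent of the Bose-Mesner algebra: a nonzero idempotent which is not the
sum of two nonzero orthogonal idempotents of the algebra. -/
def IsPrimitiveIdempotent (e : Matrix V V ℝ) : Prop :=
  e ∈ S.boseMesner ∧ e ≠ 0 ∧ e * e = e ∧
    ∀ f ∈ S.boseMesner, ∀ g ∈ S.boseMesner,
      f * f = f → g * g = g → f * g = 0 → g * f = 0 → e = f + g → f = 0 ∨ g = 0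

/-- `E_0, …, E_d` is a list without repetition of all the primitive idempotents of the Bose-Mesner
algebra, and it starts with `E_0 = |V|⁻¹ J`, where `J` is the all-one matrix. -/
structure IsIdempotentOrdering (E : Fin (d + 1) → Matrix V V ℝ) : Prop where
  injective : Function.Injective E
  range_eq : Set.range E = {e | S.IsPrimitiveIdempotent e}
  zero_eq : E 0 = (Fintype.card V : ℝ)⁻¹ • Matrix.of fun _ _ => (1 : ℝ)

/-- `P j i` is the entry `P_j(i)` of the first eigenmatrix: `D_j = ∑_i P_j(i) E_i`. -/
def IsFirstEigenmatrix (E : Fin (d + 1) → Matrix V V ℝ) (P : Fin (d + 1) → Fin (d + 1) → ℝ) :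
    Prop :=
  ∀ j, S.adj j = ∑ i, P j i • E i

/-- `Q j i` is the entry `Q_j(i)` of the second eigenmatrix: `|V| E_j = ∑_i Q_j(i) D_i`. -/
def IsSecondEigenmatrix (E : Fin (d + 1) → Matrix V V ℝ) (Q : Fin (d + 1) → Fin (d + 1) → ℝ) :
    Prop :=
  ∀ j, (Fintype.card V : ℝ) • E j = ∑ i, Q j i • S.adj i

end AssociationScheme

/-- `q i j k` is the Krein number `q_{i,j}^k` with respect to the primitive idempotents `E`:
`(|V| E_i) ∘ (|V| E_j) = ∑_k q_{i,j}^k |V| E_k`, where `∘` is the entrywise product. -/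
def IsKreinNumbers {V : Type*} [Fintype V] {d : ℕ} (E : Fin (d + 1) → Matrix V V ℝ)
    (q : Fin (d + 1) → Fin (d + 1) → Fin (d + 1) → ℝ) : Prop :=
  ∀ i j, ((Fintype.card V : ℝ) • E i) ⊙ ((Fintype.card V : ℝ) • E j) =
    ∑ k, q i j k • ((Fintype.card V : ℝ) • E k)

/-- The scheme with primitive idempotents `E_0, …, E_d` (in this order) is Q-polynomial: there are
polynomials `v_i` of degree `i` such that `|V| E_i` is `v_i` applied entrywise to `|V| E_1`. -/
def IsQPolynomial {V : Type*} [Fintype V] {d : ℕ} (E : Fin (d + 1) → Matrix V V ℝ) : Prop :=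
  ∃ v : Fin (d + 1) → Polynomial ℝ, (∀ i, (v i).degree = ((i : ℕ) : WithBot ℕ)) ∧
    ∀ o : Fin (d + 1), (o : ℕ) = 1 → ∀ i x y,
      (Fintype.card V : ℝ) * E i x y = (v i).eval ((Fintype.card V : ℝ) * E o x y)

/-- The binomial coefficient `a` choose `k`, with the convention that it is `0` for `k < 0`.
It is only used with `0 ≤ a` when `0 ≤ k`. -/
def binom (a k : ℤ) : ℝ :=
  if k < 0 then 0 else (a.toNat.choose k.toNat : ℝ)

end

/-! With the average over the sphere as inner product, the homogeneous polynomials of degree k have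
a reproducing kernel. It is invariant under isometries, hence of the form N_k(x·y) with N_k a
polynomial of degree at most k, and N_k(1) is the dimension of the space (`exists_isZonalKernel`).
Multiplication by |x|^2 changes nothing on the sphere, so degree k sits inside degree k+2j and the
kernels compose like nested projections. A design inherits the law ∑_z N_k(x·z) N_{k+2j}(z·y) = |X|
N_k(x·y) as long as 2k+2j ≤ t (`IsSphericalDesign.sum_zonal_mul`), which covers all degrees up to
s-2.

Antipodality supplies the two missing kernels. The projections of the functions on X onto even and
onto odd functions have kernel (|X|/2)(δ_{x,y} ± δ_{x,-y}), up to the factor |X|. They are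
polynomials in x·y of degrees s-1 and s, obtained from the product of the linear factors vanishing
on A(X) without -1 (`IsSphericalDesign.exists_isKernelSequence`). In the resulting sequence f_0, …,
f_s of two nested chains, one for each parity, the differences f_k - f_{k-2} divided by |X| are s+1
nonzero, mutually orthogonal idempotents (`sum_diffTwo_mul`, `diffTwo_ne_zero`). They play the role
of the harmonic projections.

There are exactly s+1 inner products including 1, so these idempotents span all matrices whose
entries depend only on x·y (`IsSpectralFamily.exists_coeff`). That space is therefore closed under
multiplication: this is the association scheme, the idempotents are its primitive ones, and Q_j(i)
is a value of the j-th difference. Replacing y by -y multiplies the k-th difference by (-1)^k, which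
gives the statements on P_1, on Q and on the vanishing of Krein numbers; the values at 1 are the
multiplicities.

The k-th difference has degree exactly k (`degree_eq`), whence the Q-polynomial property and, with
the symmetry of m_k q_{i,j}^k in j and k, the tridiagonal form. The nonzero entries are determined
by the column sums c_j + b_j = m_1 = n and by m_j b_j = m_{j+1} c_{j+1}. -/

/-! ### Averages of polynomials over the sphere -/

section SphereMean

open MeasureTheory MvPolynomial

/-- The action of a linear isometry on the unit sphere. -/
noncomputable def sphereEquiv {E : Type*} [NormedAddCommGroup E] [InnerProductSpace ℝ E]
    [MeasurableSpace E] [BorelSpace E] (g : E ≃ₗᵢ[ℝ] E) :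
    Metric.sphere (0 : E) 1 ≃ᵐ Metric.sphere (0 : E) 1 where
  toFun u := ⟨g u, by simp⟩
  invFun u := ⟨g.symm u, by simp⟩
  left_inv u := by simp
  right_inv u := by simp
  measurable_toFun := by
    refine Measurable.subtype_mk ?_
    exact g.continuous.measurable.comp measurable_subtype_coe
  measurable_invFun := by
    refine Measurable.subtype_mk ?_
    exact g.symm.continuous.measurable.comp measurable_subtype_coe

open scoped Pointwise in
-- The surface measure of a set is, up to a constant, the volume of the cone over it with apex at
-- the origin. A linear isometry commutes with forming cones and preserves volume.
theorem measurePreserving_sphereEquiv {E : Type*} [NormedAddCommGroup E] [InnerProductSpace ℝ E]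
    [FiniteDimensional ℝ E] [MeasurableSpace E] [BorelSpace E] (g : E ≃ₗᵢ[ℝ] E) :
    MeasurePreserving (sphereEquiv g) (volume : Measure E).toSphere
      (volume : Measure E).toSphere := by
  refine ⟨(sphereEquiv g).measurable, ?_⟩
  ext s hs
  rw [Measure.map_apply (sphereEquiv g).measurable hs, Measure.toSphere_apply' _ hs,
    Measure.toSphere_apply' _ ((sphereEquiv g).measurable hs)]
  congr 1
  rw [← g.measurePreserving.measure_preimage_equiv (f := g.toMeasurableEquiv)
    (Set.Ioo (0 : ℝ) 1 • (Subtype.val '' s))]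
  congr 1
  ext x
  simp only [Set.mem_smul, Set.mem_image, Set.mem_preimage, Subtype.exists]
  constructor
  · rintro ⟨r, hr, _, ⟨u, hu, hu', rfl⟩, rfl⟩
    exact ⟨r, hr, g u, ⟨g u, by simpa using hu, hu', rfl⟩, (g.map_smul r u).symm⟩
  · rintro ⟨r, hr, _, ⟨u, hu, hu', rfl⟩, h⟩
    change r • u = g x at h
    refine ⟨r, hr, g.symm u, ⟨g.symm u, by simpa using hu, ?_, rfl⟩, ?_⟩
    · simpa [sphereEquiv] using hu'
    · apply g.injective
      simpa using h

theorem continuous_eval_euclidean {n : ℕ} (p : MvPolynomial (Fin n) ℝ) :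
    Continuous fun u : EuclideanSpace ℝ (Fin n) => eval (fun k => u k) p := by
  refine p.continuous_eval.comp ?_
  fun_prop

theorem integrable_eval_sphere {n : ℕ} (p : MvPolynomial (Fin n) ℝ) :
    Integrable (fun u : Metric.sphere (0 : EuclideanSpace ℝ (Fin n)) 1 =>
      eval (fun k => (u : EuclideanSpace ℝ (Fin n)) k) p)
      (volume : Measure (EuclideanSpace ℝ (Fin n))).toSphere :=
  ((continuous_eval_euclidean p).comp continuous_subtype_val).integrable_of_hasCompactSupport
    (HasCompactSupport.of_compactSpace _)

/-- The average of a polynomial over the unit sphere. -/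
noncomputable def sphereMean (n : ℕ) : MvPolynomial (Fin n) ℝ →ₗ[ℝ] ℝ where
  toFun p := ⨍ u : Metric.sphere (0 : EuclideanSpace ℝ (Fin n)) 1,
    eval (fun k => (u : EuclideanSpace ℝ (Fin n)) k) p
      ∂((volume : Measure (EuclideanSpace ℝ (Fin n))).toSphere)
  map_add' p q := by
    simp only [average_eq, map_add]
    rw [integral_add (integrable_eval_sphere p) (integrable_eval_sphere q), smul_add]
  map_smul' a p := by
    simp only [average_eq, smul_eval, RingHom.id_apply]
    rw [integral_const_mul, smul_eq_mul, smul_eq_mul, smul_eq_mul]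
    ring

theorem toSphere_volume_ne_zero {n : ℕ} (hn : n ≠ 0) :
    (volume : Measure (EuclideanSpace ℝ (Fin n))).toSphere ≠ 0 := by
  rw [Ne, Measure.toSphere_eq_zero_iff_finrank]
  simpa using hn

theorem sphereMean_C {n : ℕ} (hn : n ≠ 0) (a : ℝ) : sphereMean n (C a) = a := by
  have := toSphere_volume_ne_zero hn
  have : NeZero (volume : Measure (EuclideanSpace ℝ (Fin n))).toSphere := ⟨this⟩
  simp [sphereMean, average_const]

theorem sphereMean_congr {n : ℕ} {p q : MvPolynomial (Fin n) ℝ}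
    (h : ∀ u : EuclideanSpace ℝ (Fin n), ‖u‖ = 1 → eval (fun k => u k) p = eval (fun k => u k) q) :
    sphereMean n p = sphereMean n q := by
  simp only [sphereMean, LinearMap.coe_mk, AddHom.coe_mk]
  congr 1
  ext u
  exact h u (by simp)

/-- A nonnegative continuous function with zero integral vanishes identically, because the surface
measure charges every nonempty open set. -/
theorem eval_eq_zero_of_sphereMean_sq {n : ℕ} {p : MvPolynomial (Fin n) ℝ}
    (h : sphereMean n (p * p) = 0) (u : EuclideanSpace ℝ (Fin n)) (hu : ‖u‖ = 1) :
    eval (fun k => u k) p = 0 := by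
  have hn : n ≠ 0 := by
    rintro rfl
    rw [Subsingleton.elim u 0] at hu
    simp at hu
  have hμ := toSphere_volume_ne_zero hn
  set μ := (volume : Measure (EuclideanSpace ℝ (Fin n))).toSphere with hμdef
  have hμr : μ.real Set.univ ≠ 0 := by
    rw [Measure.real, ENNReal.toReal_ne_zero]
    exact ⟨by simpa using hμ, measure_ne_top _ _⟩
  have h0 : ∫ u : Metric.sphere (0 : EuclideanSpace ℝ (Fin n)) 1,
      eval (fun k => (u : EuclideanSpace ℝ (Fin n)) k) (p * p) ∂μ = 0 := by
    simp only [sphereMean, LinearMap.coe_mk, AddHom.coe_mk, average_eq] at h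
    rw [smul_eq_mul] at h
    exact (mul_eq_zero.mp h).resolve_left (inv_ne_zero hμr)
  rw [integral_eq_zero_iff_of_nonneg (fun u => by simpa using mul_self_nonneg _)
    (integrable_eval_sphere _)] at h0
  have hc : Continuous fun u : Metric.sphere (0 : EuclideanSpace ℝ (Fin n)) 1 =>
      eval (fun k => (u : EuclideanSpace ℝ (Fin n)) k) (p * p) :=
    (continuous_eval_euclidean _).comp continuous_subtype_val
  have h1 := Continuous.ae_eq_iff_eq μ hc (g := 0) continuous_const |>.mp h0
  have h2 := congrFun h1 ⟨u, by simpa using hu⟩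
  simpa using h2

theorem sphereMean_sq_nonneg {n : ℕ} (p : MvPolynomial (Fin n) ℝ) :
    0 ≤ sphereMean n (p * p) := by
  simp only [sphereMean, LinearMap.coe_mk, AddHom.coe_mk, average_eq, smul_eq_mul]
  refine mul_nonneg (inv_nonneg.mpr measureReal_nonneg) (integral_nonneg fun u => ?_)
  simpa using mul_self_nonneg _

/-- The composition of a polynomial with a linear map. -/
noncomputable def linearPullback {n : ℕ}
    (g : EuclideanSpace ℝ (Fin n) →ₗ[ℝ] EuclideanSpace ℝ (Fin n)) :
    MvPolynomial (Fin n) ℝ →ₐ[ℝ] MvPolynomial (Fin n) ℝ :=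
  aeval fun k => ∑ j, C (g (EuclideanSpace.single j 1) k) * X j

theorem eval_linearPullback {n : ℕ}
    (g : EuclideanSpace ℝ (Fin n) →ₗ[ℝ] EuclideanSpace ℝ (Fin n)) (p : MvPolynomial (Fin n) ℝ)
    (u : EuclideanSpace ℝ (Fin n)) :
    eval (fun k => u k) (linearPullback g p) = eval (fun k => g u k) p := by
  have hu : u = ∑ j, u j • EuclideanSpace.single j (1 : ℝ) := by
    ext k
    simp [Pi.single_apply]
  induction p using MvPolynomial.induction_on with
  | C a => simp [linearPullback]
  | add p q hp hq => simp [hp, hq]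
  | mul_X p k hp =>
    rw [map_mul, map_mul, map_mul, hp]
    congr 1
    conv_rhs => rw [eval_X, hu]
    simp [linearPullback, mul_comm]

theorem isHomogeneous_linearPullback {n k : ℕ}
    (g : EuclideanSpace ℝ (Fin n) →ₗ[ℝ] EuclideanSpace ℝ (Fin n)) {p : MvPolynomial (Fin n) ℝ}
    (hp : p.IsHomogeneous k) : (linearPullback g p).IsHomogeneous k := by
  have := hp.aeval (S := ℝ) (n := 1)
    (fun k => ∑ j, C (g (EuclideanSpace.single j 1) k) * X j) fun i => by
      refine IsHomogeneous.sum _ _ _ fun j _ => ?_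
      exact (isHomogeneous_X ℝ j).C_mul _
  simpa [linearPullback] using this

theorem sphereMean_linearPullback {n : ℕ}
    (g : EuclideanSpace ℝ (Fin n) ≃ₗᵢ[ℝ] EuclideanSpace ℝ (Fin n)) (p : MvPolynomial (Fin n) ℝ) :
    sphereMean n (linearPullback g.toLinearEquiv.toLinearMap p) = sphereMean n p := by
  simp only [sphereMean, LinearMap.coe_mk, AddHom.coe_mk, average_eq]
  congr 1
  simp only [eval_linearPullback]
  exact (measurePreserving_sphereEquiv g).integral_comp'
    (fun u : Metric.sphere (0 : EuclideanSpace ℝ (Fin n)) 1 =>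
      eval (fun k => (u : EuclideanSpace ℝ (Fin n)) k) p)

theorem eval_smul_of_isHomogeneous {n k : ℕ} {p : MvPolynomial (Fin n) ℝ} (hp : p.IsHomogeneous k)
    (r : ℝ) (u : EuclideanSpace ℝ (Fin n)) :
    eval (fun i => (r • u) i) p = r ^ k * eval (fun i => u i) p := by
  rw [eval_eq', eval_eq', Finset.mul_sum]
  refine Finset.sum_congr rfl fun d hd => ?_
  have hdk : ∑ i, d i = k := by
    have := hp (mem_support_iff.mp hd)
    rw [← this, Finsupp.weight_apply, Finsupp.sum_fintype] <;> simp
  simp only [PiLp.smul_apply, smul_eq_mul, mul_pow, Finset.prod_mul_distrib,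
    Finset.prod_pow_eq_pow_sum, hdk]
  ring

/-- Definiteness of the inner product on forms: vanishing on the sphere spreads to all nonzero
vectors by homogeneity and to the origin by continuity. -/
theorem eq_zero_of_sphereMean_sq {n k : ℕ} (hn : n ≠ 0) {p : MvPolynomial (Fin n) ℝ}
    (hp : p.IsHomogeneous k) (h : sphereMean n (p * p) = 0) : p = 0 := by
  have h1 := eval_eq_zero_of_sphereMean_sq h
  have h2 : ∀ u : EuclideanSpace ℝ (Fin n), u ≠ 0 → eval (fun i => u i) p = 0 := by
    intro u hu
    have := eval_smul_of_isHomogeneous hp (‖u‖) (‖u‖⁻¹ • u)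
    rw [smul_inv_smul₀ (norm_ne_zero_iff.mpr hu)] at this
    rw [this, h1 _ (by rw [norm_smul, norm_inv, norm_norm, inv_mul_cancel₀ (norm_ne_zero_iff.mpr hu)]),
      mul_zero]
  refine hp.eq_zero_of_forall_eval_eq_zero fun r => ?_
  by_cases hr : WithLp.toLp 2 r = 0
  · have hc := continuous_eval_euclidean p
    have hne : Nontrivial (EuclideanSpace ℝ (Fin n)) := by
      have : Nonempty (Fin n) := ⟨⟨0, Nat.pos_of_ne_zero hn⟩⟩
      infer_instance
    have : (fun u : EuclideanSpace ℝ (Fin n) => eval (fun k => u k) p) = fun _ => 0 := by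
      refine Continuous.ext_on (dense_compl_singleton (0 : EuclideanSpace ℝ (Fin n))) hc
        continuous_const ?_
      intro u hu
      exact h2 u hu
    exact congrFun this (WithLp.toLp 2 r)
  · exact h2 (WithLp.toLp 2 r) hr

theorem finrank_homogeneousSubmodule_fin (n k : ℕ) :
    Module.finrank ℝ (homogeneousSubmodule (Fin n) ℝ k) = (n + k - 1).choose k := by
  rw [homogeneousSubmodule_eq_finsupp_supported]
  have e : AddMonoidAlgebra.supported ℝ ℝ {d : Fin n →₀ ℕ | d.degree = k} ≃ₗ[ℝ]
      ({d : Fin n →₀ ℕ | d.degree = k} →₀ ℝ) := AddMonoidAlgebra.supportedEquivFinsupp _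
  rw [e.finrank_eq]
  have hset : {d : Fin n →₀ ℕ | d.degree = k} =
      ((Finset.univ : Finset (Fin n)).finsuppAntidiag k : Set (Fin n →₀ ℕ)) := by
    ext d
    simp [Finset.mem_finsuppAntidiag, Finsupp.degree_eq_sum]
  rw [hset, Module.finrank_finsupp_self]
  simp [Finset.card_finsuppAntidiag_nat_eq_choose]

end SphereMean

/-! ### Reproducing kernels of homogeneous polynomials and their zonal form -/

section ZonalKernel

open MvPolynomial

theorem exists_orthonormal_homogeneous {n : ℕ} (hn : n ≠ 0) (k : ℕ) :
    ∃ ψ : Fin ((n + k - 1).choose k) → MvPolynomial (Fin n) ℝ,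
      (∀ a, (ψ a).IsHomogeneous k) ∧ (∀ a, sphereMean n (ψ a * ψ a) = 1) ∧
      ∀ f : MvPolynomial (Fin n) ℝ, f.IsHomogeneous k →
        f = ∑ a, sphereMean n (ψ a * f) • ψ a := by
  have : FiniteDimensional ℝ (homogeneousSubmodule (Fin n) ℝ k) :=
    Module.Finite.iff_fg.mpr (homogeneousSubmodule_fg _ _ k)
  let core : InnerProductSpace.Core ℝ (homogeneousSubmodule (Fin n) ℝ k) :=
    { inner p q := sphereMean n (p * q)
      conj_inner_symm p q := by simp [mul_comm]
      re_inner_nonneg p := by simpa using sphereMean_sq_nonneg (p : MvPolynomial (Fin n) ℝ)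
      add_left p q r := by simp [add_mul]
      smul_left p q r := by simp
      definite p hp := Subtype.ext (eq_zero_of_sphereMean_sq hn p.2 hp) }
  let _ : NormedAddCommGroup (homogeneousSubmodule (Fin n) ℝ k) := core.toNormedAddCommGroup
  let _ : InnerProductSpace ℝ (homogeneousSubmodule (Fin n) ℝ k) :=
    InnerProductSpace.ofCore core.toCore
  have hinner : ∀ p q : homogeneousSubmodule (Fin n) ℝ k,
      inner ℝ p q = sphereMean n (p * q) := fun _ _ => rfl
  let b := (stdOrthonormalBasis ℝ (homogeneousSubmodule (Fin n) ℝ k)).reindex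
    (finCongr (finrank_homogeneousSubmodule_fin n k))
  refine ⟨fun a => b a, fun a => (b a).2, fun a => ?_, fun f hf => ?_⟩
  · rw [← hinner, real_inner_self_eq_norm_sq, b.norm_eq_one, one_pow]
  · have := congrArg Subtype.val (b.sum_repr' ⟨f, hf⟩)
    simp only [hinner, Submodule.coe_sum, Submodule.coe_smul] at this
    exact this.symm

/-- The homogeneous polynomials of degree `k` have a reproducing kernel for the average over the
sphere. -/
theorem exists_reproducingKernel {n : ℕ} (hn : n ≠ 0) (k : ℕ) :
    ∃ κ : EuclideanSpace ℝ (Fin n) → MvPolynomial (Fin n) ℝ,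
      (∀ x, (κ x).IsHomogeneous k) ∧
      (∀ x f, f.IsHomogeneous k → sphereMean n (κ x * f) = eval (fun i => x i) f) ∧
      ∃ τ : MvPolynomial (Fin n) ℝ, sphereMean n τ = (n + k - 1).choose k ∧
        ∀ x, eval (fun i => x i) τ = eval (fun i => x i) (κ x) := by
  obtain ⟨ψ, hψ, h1, hf⟩ := exists_orthonormal_homogeneous hn k
  -- The trace of the kernel is `τ = ∑ ψ_a²`, whose average is the number of basis elements.
  refine ⟨fun x => ∑ a, eval (fun i => x i) (ψ a) • ψ a, fun x => ?_, fun x f hfk => ?_,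
    ∑ a, ψ a * ψ a, ?_, fun x => ?_⟩
  · exact Submodule.sum_mem (homogeneousSubmodule (Fin n) ℝ k)
      fun a _ => Submodule.smul_mem _ _ (hψ a)
  · conv_rhs => rw [hf f hfk]
    simp only [Finset.sum_mul, smul_mul_assoc, map_sum, map_smul, smul_eval, smul_eq_mul]
    exact Finset.sum_congr rfl fun a _ => mul_comm _ _
  · simp [h1]
  · simp [smul_eval]

/-- The pullback along g of the kernel at g x reproduces values at x, by invariance of the average.
Definiteness makes the kernel at x unique. -/
theorem reproducingKernel_isometry {n k : ℕ} (hn : n ≠ 0)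
    {κ : EuclideanSpace ℝ (Fin n) → MvPolynomial (Fin n) ℝ}
    (hκ : ∀ x, (κ x).IsHomogeneous k)
    (hr : ∀ x f, f.IsHomogeneous k → sphereMean n (κ x * f) = eval (fun i => x i) f)
    (g : EuclideanSpace ℝ (Fin n) ≃ₗᵢ[ℝ] EuclideanSpace ℝ (Fin n))
    (x y : EuclideanSpace ℝ (Fin n)) :
    eval (fun i => g y i) (κ (g x)) = eval (fun i => y i) (κ x) := by
  set G := linearPullback g.toLinearEquiv.toLinearMap with hG
  set G' := linearPullback g.symm.toLinearEquiv.toLinearMap with hG'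
  have hhom : (G (κ (g x)) - κ x).IsHomogeneous k :=
    (isHomogeneous_linearPullback _ (hκ _)).sub (hκ x)
  have key : ∀ f : MvPolynomial (Fin n) ℝ, f.IsHomogeneous k →
      sphereMean n (G (κ (g x)) * f) = eval (fun i => x i) f := by
    intro f hf
    have h1 : sphereMean n (G (κ (g x)) * f) = sphereMean n (G (κ (g x) * G' f)) := by
      refine sphereMean_congr fun u _ => ?_
      simp only [map_mul, hG, hG', eval_linearPullback]
      congr 3
      ext i
      exact (congrArg (fun v : EuclideanSpace ℝ (Fin n) => v i) (g.symm_apply_apply u)).symm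
    rw [h1, hG, sphereMean_linearPullback, hr _ _ (isHomogeneous_linearPullback _ hf),
      eval_linearPullback]
    congr 2
    ext i
    exact congrArg (fun v : EuclideanSpace ℝ (Fin n) => v i) (g.symm_apply_apply x)
  have h0 : G (κ (g x)) - κ x = 0 := by
    refine eq_zero_of_sphereMean_sq hn hhom ?_
    rw [sub_mul, map_sub, key _ hhom, hr _ _ hhom, sub_self]
  have := eval_linearPullback g.toLinearEquiv.toLinearMap (κ (g x)) y
  rw [← hG, sub_eq_zero.mp h0] at this
  exact this.symm

/-- Two reflections suffice. The first takes x to x'. The second takes the image of y to y' and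
fixes x', because equality of the inner products makes x' orthogonal to the difference. -/
theorem exists_isometry_pair {E : Type*} [NormedAddCommGroup E] [InnerProductSpace ℝ E]
    {x y x' y' : E} (hx : ‖x‖ = ‖x'‖) (hy : ‖y‖ = ‖y'‖) (h : inner ℝ x y = inner ℝ x' y') :
    ∃ g : E ≃ₗᵢ[ℝ] E, g x = x' ∧ g y = y' := by
  set g₁ := (ℝ ∙ (x - x'))ᗮ.reflection
  have h₁ : g₁ x = x' := Submodule.reflection_sub hx
  set g₂ := (ℝ ∙ (g₁ y - y'))ᗮ.reflection
  have h₂ : g₂ (g₁ y) = y' := Submodule.reflection_sub (by rw [g₁.norm_map, hy])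
  have h₃ : g₂ x' = x' := by
    refine Submodule.reflection_mem_subspace_eq_self ?_
    rw [Submodule.mem_orthogonal_singleton_iff_inner_left, inner_sub_right, ← h, sub_eq_zero]
    conv_lhs => rw [← h₁]
    exact g₁.inner_map_map x y
  exact ⟨g₁.trans g₂, by simp [h₁, h₃], by simp [h₂]⟩

/-- Restricting a polynomial to a circle through two orthogonal points `e`, `f`. -/
theorem exists_eval_circle {n : ℕ} (e f : EuclideanSpace ℝ (Fin n)) {k : ℕ}
    (p : MvPolynomial (Fin n) ℝ) (hp : p.totalDegree ≤ k) :
    ∃ q r : Polynomial ℝ, q.natDegree ≤ k ∧ ∀ c σ : ℝ, c ^ 2 + σ ^ 2 = 1 →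
      eval (fun i => (c • e + σ • f) i) p = q.eval c + σ * r.eval c := by
  -- Even powers of σ are eliminated by σ² = 1 - c². Bounding the degree of `X * r` says that r has
  -- degree at most `d.degree - 1`, and r = 0 in degree 0; this keeps the term r₁ r₂ (1 - c²) of a
  -- product within the bound.
  have mono : ∀ d : Fin n →₀ ℕ, ∃ q r : Polynomial ℝ, q.natDegree ≤ d.degree ∧
      (Polynomial.X * r).natDegree ≤ d.degree ∧ ∀ c σ : ℝ, c ^ 2 + σ ^ 2 = 1 →
      eval (fun i => (c • e + σ • f) i) (monomial d 1) = q.eval c + σ * r.eval c := by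
    intro d
    induction d using Finsupp.induction_linear with
    | zero => exact ⟨1, 0, by simp, by simp, by simp⟩
    | add d₁ d₂ h₁ h₂ =>
      obtain ⟨q₁, r₁, hq₁, hr₁, h₁⟩ := h₁
      obtain ⟨q₂, r₂, hq₂, hr₂, h₂⟩ := h₂
      have hX : ∀ r : Polynomial ℝ, r.natDegree ≤ (Polynomial.X * r).natDegree := by
        intro r
        by_cases hr : r = 0
        · simp [hr]
        · rw [Polynomial.natDegree_X_mul hr]; omega
      rw [map_add Finsupp.degree]
      refine ⟨q₁ * q₂ + r₁ * r₂ - (Polynomial.X * r₁) * (Polynomial.X * r₂),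
        q₁ * r₂ + r₁ * q₂, ?_, ?_, ?_⟩
      · refine Polynomial.natDegree_sub_le_of_le (Polynomial.natDegree_add_le_of_degree_le
          (Polynomial.natDegree_mul_le_of_le hq₁ hq₂)
          (Polynomial.natDegree_mul_le_of_le ((hX _).trans hr₁) ((hX _).trans hr₂)))
          (Polynomial.natDegree_mul_le_of_le hr₁ hr₂) |>.trans (by simp)
      · have : Polynomial.X * (q₁ * r₂ + r₁ * q₂) =
            q₁ * (Polynomial.X * r₂) + (Polynomial.X * r₁) * q₂ := by ring
        rw [this]
        exact Polynomial.natDegree_add_le_of_degree_le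
          (Polynomial.natDegree_mul_le_of_le hq₁ hr₂) (Polynomial.natDegree_mul_le_of_le hr₁ hq₂)
      · intro c σ hc
        have : monomial (d₁ + d₂) (1 : ℝ) = monomial d₁ 1 * monomial d₂ 1 := by
          rw [monomial_mul, one_mul]
        rw [this, map_mul, h₁ c σ hc, h₂ c σ hc]
        simp only [Polynomial.eval_sub, Polynomial.eval_add, Polynomial.eval_mul,
          Polynomial.eval_X]
        linear_combination (Polynomial.eval c r₁ * Polynomial.eval c r₂) * hc
    | single i m =>
      induction m with
      | zero => exact ⟨1, 0, by simp, by simp, by simp⟩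
      | succ m ih =>
        obtain ⟨q, r, hq, hr, h⟩ := ih
        rw [Finsupp.degree_single] at hq hr ⊢
        have hr' : r.natDegree ≤ m := by
          by_cases hr0 : r = 0
          · simp [hr0]
          · rw [Polynomial.natDegree_X_mul hr0] at hr; omega
        have hXr : (Polynomial.X * (Polynomial.X * r)).natDegree ≤ m + 1 := by
          rw [add_comm]
          exact Polynomial.natDegree_mul_le_of_le Polynomial.natDegree_X_le hr
        refine ⟨Polynomial.C (e i) * (Polynomial.X * q) + Polynomial.C (f i) * r -
          Polynomial.C (f i) * (Polynomial.X * (Polynomial.X * r)),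
          Polynomial.C (e i) * (Polynomial.X * r) + Polynomial.C (f i) * q, ?_, ?_, ?_⟩
        · refine (Polynomial.natDegree_sub_le_of_le (Polynomial.natDegree_add_le_of_degree_le
            ((Polynomial.natDegree_C_mul_le _ _).trans ?_)
            ((Polynomial.natDegree_C_mul_le _ _).trans (hr'.trans (Nat.le_succ m))))
            ((Polynomial.natDegree_C_mul_le _ _).trans hXr)).trans (by simp)
          rw [Nat.succ_eq_one_add]
          exact Polynomial.natDegree_mul_le_of_le Polynomial.natDegree_X_le hq
        · rw [Nat.add_comm m 1]
          refine Polynomial.natDegree_mul_le_of_le Polynomial.natDegree_X_le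
            (Polynomial.natDegree_add_le_of_degree_le
            ((Polynomial.natDegree_C_mul_le _ _).trans hr)
            ((Polynomial.natDegree_C_mul_le _ _).trans hq))
        · intro c σ hc
          have : monomial (Finsupp.single i (m + 1)) (1 : ℝ) =
              monomial (Finsupp.single i m) 1 * X i := by
            rw [X, monomial_mul, one_mul, ← Finsupp.single_add]
          rw [this, map_mul, h c σ hc, eval_X]
          simp only [Polynomial.eval_sub, Polynomial.eval_add, Polynomial.eval_mul,
            Polynomial.eval_X, Polynomial.eval_C, PiLp.add_apply, PiLp.smul_apply, smul_eq_mul]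
          linear_combination (f i * Polynomial.eval c r) * hc
  choose q r hq _ h using mono
  refine ⟨∑ d ∈ p.support, Polynomial.C (coeff d p) * q d,
    ∑ d ∈ p.support, Polynomial.C (coeff d p) * r d, ?_, fun c σ hc => ?_⟩
  · refine Polynomial.natDegree_sum_le_of_forall_le _ _ fun d hd => ?_
    refine (Polynomial.natDegree_C_mul_le _ _).trans ((hq d).trans (le_trans ?_ hp))
    rw [Finsupp.degree_eq_sum]
    have := le_totalDegree hd
    rwa [Finsupp.sum_fintype _ _ (fun _ => rfl)] at this
  · conv_lhs => rw [p.as_sum]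
    rw [map_sum, Polynomial.eval_finsetSum, Polynomial.eval_finsetSum, Finset.mul_sum,
      ← Finset.sum_add_distrib]
    refine Finset.sum_congr rfl fun d _ => ?_
    have : monomial d (coeff d p) = C (coeff d p) * monomial d 1 := by
      rw [C_mul_monomial, mul_one]
    rw [this, map_mul, h d c σ hc, eval_C]
    simp only [Polynomial.eval_mul, Polynomial.eval_C]
    ring

/-- A zonal polynomial of degree `k`: the reproducing kernel of the homogeneous polynomials of
degree `k` on the sphere is a polynomial in the inner product. -/
structure IsZonalKernel (n k : ℕ) (N : Polynomial ℝ)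
    (κ : EuclideanSpace ℝ (Fin n) → MvPolynomial (Fin n) ℝ) : Prop where
  isHomogeneous : ∀ x, (κ x).IsHomogeneous k
  sphereMean_mul : ∀ x f, f.IsHomogeneous k → sphereMean n (κ x * f) = eval (fun i => x i) f
  natDegree_le : N.natDegree ≤ k
  eval_one : N.eval 1 = (n + k - 1).choose k
  eval_inner : ∀ x y : EuclideanSpace ℝ (Fin n), ‖x‖ = 1 → ‖y‖ = 1 →
    eval (fun i => y i) (κ x) = N.eval (inner ℝ x y)
  eval_neg : ∀ c : ℝ, |c| ≤ 1 → N.eval (-c) = (-1) ^ k * N.eval c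

/-- Isometries are transitive on pairs of unit vectors with a given inner product, so the kernel is
determined by its values with pole e on a circle through e. There it has the form q(c) + σ r(c), and
symmetry in σ removes the second term. -/
theorem exists_isZonalKernel {n : ℕ} (hn : 2 ≤ n) (k : ℕ) : ∃ N κ, IsZonalKernel n k N κ := by
  have hn0 : n ≠ 0 := by omega
  obtain ⟨κ, hκ, hr, τ, hτ, hτκ⟩ := exists_reproducingKernel hn0 k
  let e : EuclideanSpace ℝ (Fin n) := EuclideanSpace.single ⟨0, by omega⟩ 1
  let f : EuclideanSpace ℝ (Fin n) := EuclideanSpace.single ⟨1, by omega⟩ 1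
  have he : ‖e‖ = 1 := by simp [e]
  have hf : ‖f‖ = 1 := by simp [f]
  have hef : inner ℝ e f = 0 := by
    simp [e, f, EuclideanSpace.inner_single_left]
  obtain ⟨N, r, hN, hcirc⟩ := exists_eval_circle e f (κ e) (hκ e).totalDegree_le
  have hee : inner ℝ e e = (1 : ℝ) := by rw [real_inner_self_eq_norm_sq, he, one_pow]
  have hff : inner ℝ f f = (1 : ℝ) := by rw [real_inner_self_eq_norm_sq, hf, one_pow]
  have hfe : inner ℝ f e = 0 := by rw [real_inner_comm, hef]
  have hnorm : ∀ c σ : ℝ, c ^ 2 + σ ^ 2 = 1 → ‖c • e + σ • f‖ = 1 := by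
    intro c σ hc
    have : ‖c • e + σ • f‖ ^ 2 = 1 := by
      rw [← real_inner_self_eq_norm_sq]
      simp only [inner_add_left, inner_add_right, real_inner_smul_left, real_inner_smul_right,
        hee, hff, hef, hfe]
      linear_combination hc
    nlinarith [norm_nonneg (c • e + σ • f)]
  have hin : ∀ c σ : ℝ, inner ℝ e (c • e + σ • f) = c := by
    intro c σ
    rw [inner_add_right, real_inner_smul_right, real_inner_smul_right, hee, hef]
    ring
  have hpole : ∀ c σ : ℝ, c ^ 2 + σ ^ 2 = 1 →
      eval (fun i => (c • e + σ • f) i) (κ e) = N.eval c := by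
    intro c σ hc
    -- An isometry fixing e exchanges the points with coordinates (c, σ) and (c, -σ), so invariance
    -- forces σ r(c) = 0.
    have hc' : c ^ 2 + (-σ) ^ 2 = 1 := by rw [neg_sq, hc]
    obtain ⟨g, hg, hg'⟩ := exists_isometry_pair (x := e) (x' := e) (y := c • e + σ • f)
      (y' := c • e + (-σ) • f) rfl ((hnorm c σ hc).trans (hnorm c (-σ) hc').symm)
      ((hin c σ).trans (hin c (-σ)).symm)
    have h1 := reproducingKernel_isometry hn0 hκ hr g e (c • e + σ • f)
    rw [hg, hg', hcirc c σ hc, hcirc c (-σ) hc'] at h1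
    rw [hcirc c σ hc]
    linarith
  have heval : ∀ x y : EuclideanSpace ℝ (Fin n), ‖x‖ = 1 → ‖y‖ = 1 →
      eval (fun i => y i) (κ x) = N.eval (inner ℝ x y) := by
    intro x y hx hy
    set c : ℝ := inner ℝ x y
    have hcle : |c| ≤ 1 := by
      have := abs_real_inner_le_norm x y
      rwa [hx, hy, one_mul] at this
    have hc : c ^ 2 + (√(1 - c ^ 2)) ^ 2 = 1 := by
      rw [Real.sq_sqrt]
      · ring
      · have := (sq_le_one_iff_abs_le_one c).mpr hcle
        linarith
    obtain ⟨g, hg, hg'⟩ := exists_isometry_pair (x := x) (x' := e) (y := y)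
      (y' := c • e + √(1 - c ^ 2) • f) (hx.trans he.symm) (hy.trans (hnorm _ _ hc).symm)
      (hin _ _).symm
    rw [← reproducingKernel_isometry hn0 hκ hr g x y, hg, hg', hpole _ _ hc]
  refine ⟨N, κ, hκ, hr, hN, ?_, heval, fun c hcle => ?_⟩
  -- On the sphere the trace `τ` is the constant N(1), so N(1) equals its average, the dimension.
  · rw [← hτ, ← sphereMean_C hn0 (N.eval 1)]
    refine sphereMean_congr fun u hu => ?_
    rw [hτκ, heval u u hu hu, real_inner_self_eq_norm_sq, hu, one_pow, eval_C]
  · have hc : c ^ 2 + (√(1 - c ^ 2)) ^ 2 = 1 := by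
      rw [Real.sq_sqrt]
      · ring
      · have := (sq_le_one_iff_abs_le_one c).mpr hcle
        linarith
    have hc' : (-c) ^ 2 + (-√(1 - c ^ 2)) ^ 2 = 1 := by rw [neg_sq, neg_sq, hc]
    rw [← hpole _ _ hc, ← hpole _ _ hc', ← eval_smul_of_isHomogeneous (hκ e)]
    congr 2
    ext i
    simp

theorem IsSphericalDesign.sum_eval {n t : ℕ} {X : Finset (EuclideanSpace ℝ (Fin n))}
    (hX : IsSphericalDesign t X) {p : MvPolynomial (Fin n) ℝ} (hp : p.totalDegree ≤ t) :
    ∑ x ∈ X, eval (fun k => x k) p = X.card * sphereMean n p := by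
  have h := hX.2.2 p hp
  have hc : (X.card : ℝ) ≠ 0 := by exact_mod_cast hX.1.card_pos.ne'
  rw [div_eq_iff hc] at h
  rw [h, mul_comm]
  rfl

/-- On a design of sufficient strength the zonal kernels satisfy the same composition law as on the
sphere. -/
theorem IsSphericalDesign.sum_zonal_mul {n t k j : ℕ} {X : Finset (EuclideanSpace ℝ (Fin n))}
    (hX : IsSphericalDesign t X) {N N' : Polynomial ℝ}
    {κ κ' : EuclideanSpace ℝ (Fin n) → MvPolynomial (Fin n) ℝ}
    (h : IsZonalKernel n k N κ) (h' : IsZonalKernel n (k + 2 * j) N' κ')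
    (ht : k + (k + 2 * j) ≤ t) {x y : EuclideanSpace ℝ (Fin n)} (hx : x ∈ X) (hy : y ∈ X) :
    ∑ z ∈ X, N.eval (inner ℝ x z) * N'.eval (inner ℝ z y) = X.card * N.eval (inner ℝ x y) := by
  have hu := hX.2.1
  -- Multiplication by `ρ ^ j` lifts `κ x` to degree k + 2j without changing it on the sphere, so
  -- that the reproducing property of `κ' y` applies.
  let ρ : MvPolynomial (Fin n) ℝ := ∑ i, MvPolynomial.X i ^ 2
  have hρ : ρ.IsHomogeneous 2 := IsHomogeneous.sum _ _ _ fun i _ => isHomogeneous_X_pow i 2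
  have hρe : ∀ u : EuclideanSpace ℝ (Fin n), ‖u‖ = 1 → eval (fun i => u i) ρ = 1 := by
    intro u hu
    have := EuclideanSpace.real_norm_sq_eq u
    rw [hu] at this
    simp [ρ, ← this]
  have h1 : ∀ z ∈ X, N.eval (inner ℝ x z) * N'.eval (inner ℝ z y) =
      eval (fun i => z i) (κ x * κ' y) := by
    intro z hz
    rw [map_mul, h.eval_inner x z (hu x hx) (hu z hz), h'.eval_inner y z (hu y hy) (hu z hz),
      real_inner_comm z y]
  rw [Finset.sum_congr rfl h1, hX.sum_eval]
  · have h2 : sphereMean n (κ x * κ' y) = sphereMean n (κ' y * (κ x * ρ ^ j)) := by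
      refine sphereMean_congr fun u hu => ?_
      simp only [map_mul, map_pow, hρe u hu]
      ring
    rw [h2, h'.sphereMean_mul _ _ ((h.isHomogeneous x).mul (hρ.pow j)), map_mul, map_pow,
      hρe y (hu y hy), h.eval_inner x y (hu x hx) (hu y hy), one_pow, mul_one]
  · exact ((h.isHomogeneous x).mul (h'.isHomogeneous y)).totalDegree_le.trans ht

end ZonalKernel

/-! ### Antipodal sets and the kernel sequence of an antipodal design -/

section AntipodalSphericalSet

open Polynomial

variable {n : ℕ} {X : Finset (EuclideanSpace ℝ (Fin n))}

theorem finite_innerProducts (X : Finset (EuclideanSpace ℝ (Fin n))) :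
    (innerProducts X).Finite := by
  refine ((X ×ˢ X).finite_toSet.image fun p => inner ℝ p.1 p.2).subset ?_
  rintro a ⟨x, hx, y, hy, -, rfl⟩
  exact ⟨(x, y), by simp [hx, hy], rfl⟩

theorem inner_eq_one_iff_of_mem (hu : ∀ x ∈ X, ‖x‖ = 1) {x y : EuclideanSpace ℝ (Fin n)}
    (hx : x ∈ X) (hy : y ∈ X) : inner ℝ x y = (1 : ℝ) ↔ x = y :=
  inner_eq_one_iff_of_norm_eq_one (hu x hx) (hu y hy)

theorem inner_eq_neg_one_iff_of_mem (hu : ∀ x ∈ X, ‖x‖ = 1) {x y : EuclideanSpace ℝ (Fin n)}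
    (hx : x ∈ X) (hy : y ∈ X) : inner ℝ x y = (-1 : ℝ) ↔ x = -y := by
  rw [← inner_eq_one_iff_of_norm_eq_one (𝕜 := ℝ) (hu x hx) ((norm_neg y).trans (hu y hy)), inner_neg_right,
    neg_eq_iff_eq_neg]

theorem ne_neg_self_of_mem (hu : ∀ x ∈ X, ‖x‖ = 1) {x : EuclideanSpace ℝ (Fin n)} (hx : x ∈ X) :
    x ≠ -x := by
  intro h
  have h1 := (inner_eq_neg_one_iff_of_mem hu hx hx).mpr h
  rw [(inner_eq_one_iff_of_mem hu hx hx).mpr rfl] at h1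
  norm_num at h1

theorem one_notMem_innerProducts (hu : ∀ x ∈ X, ‖x‖ = 1) : (1 : ℝ) ∉ innerProducts X := by
  rintro ⟨x, hx, y, hy, hne, h⟩
  exact hne ((inner_eq_one_iff_of_mem hu hx hy).mp h)

theorem neg_one_mem_innerProducts (hu : ∀ x ∈ X, ‖x‖ = 1) (hanti : ∀ x ∈ X, -x ∈ X)
    (hne : X.Nonempty) : (-1 : ℝ) ∈ innerProducts X := by
  obtain ⟨x, hx⟩ := hne
  refine ⟨x, hx, -x, hanti x hx, ne_neg_self_of_mem hu hx, ?_⟩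
  rw [inner_eq_neg_one_iff_of_mem hu hx (hanti x hx), neg_neg]

theorem neg_mem_insert_innerProducts (hu : ∀ x ∈ X, ‖x‖ = 1) (hanti : ∀ x ∈ X, -x ∈ X)
    (hne : X.Nonempty) {a : ℝ} (ha : a ∈ insert 1 (innerProducts X)) :
    -a ∈ insert 1 (innerProducts X) := by
  rcases ha with rfl | ⟨x, hx, y, hy, -, rfl⟩
  · exact Or.inr (neg_one_mem_innerProducts hu hanti hne)
  · by_cases h : x = -y
    · left
      rw [(inner_eq_neg_one_iff_of_mem hu hx hy).mpr h, neg_neg]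
    · exact Or.inr ⟨x, hx, -y, hanti y hy, h, inner_neg_right x y⟩

theorem inner_mem_insert_innerProducts (hu : ∀ x ∈ X, ‖x‖ = 1) {x y : EuclideanSpace ℝ (Fin n)}
    (hx : x ∈ X) (hy : y ∈ X) : inner ℝ x y ∈ insert (1 : ℝ) (innerProducts X) := by
  by_cases h : x = y
  · exact Or.inl ((inner_eq_one_iff_of_mem hu hx hy).mpr h)
  · exact Or.inr ⟨x, hx, y, hy, h, rfl⟩

theorem two_le_dim_of_two_le_ncard (hu : ∀ x ∈ X, ‖x‖ = 1)
    (hs : 2 ≤ (innerProducts X).ncard) : 2 ≤ n := by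
  by_contra hn
  have h1 : ∀ a ∈ innerProducts X, a = -1 := by
    rintro a ⟨x, hx, y, hy, hne, rfl⟩
    rw [inner_eq_neg_one_iff_of_mem hu hx hy]
    have hx1 := EuclideanSpace.real_norm_sq_eq x
    have hy1 := EuclideanSpace.real_norm_sq_eq y
    rw [hu x hx] at hx1
    rw [hu y hy] at hy1
    have : n = 0 ∨ n = 1 := by omega
    rcases this with rfl | rfl
    · simp at hx1
    · simp only [Fin.sum_univ_one] at hx1 hy1
      have h2 : (x 0 - y 0) * (x 0 + y 0) = 0 := by linarith
      rcases mul_eq_zero.mp h2 with h | h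
      · refine absurd ?_ hne
        ext i
        rw [Subsingleton.elim i 0]
        linarith
      · ext i
        rw [Subsingleton.elim i 0]
        simp only [PiLp.neg_apply]
        linarith
  have : (innerProducts X).ncard ≤ ({-1} : Set ℝ).ncard :=
    Set.ncard_le_ncard (fun a ha => h1 a ha) (Set.finite_singleton _)
  rw [Set.ncard_singleton] at this
  omega

/-- A polynomial that takes the value `1` at `1` and `± 1` at `-1`, and vanishes at the other inner
products. -/
theorem exists_antipodal_indicator (hu : ∀ x ∈ X, ‖x‖ = 1) (hanti : ∀ x ∈ X, -x ∈ X)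
    (hne : X.Nonempty) {r : ℕ} (hr : (innerProducts X).ncard = r + 1) :
    ∃ F : ℝ[X], F.natDegree = r ∧ F ≠ 0 ∧ F.eval 1 = 1 ∧ F.eval (-1) = (-1) ^ r ∧
      ∀ a ∈ innerProducts X, a ≠ -1 → F.eval a = 0 := by
  classical
  let A := (finite_innerProducts X).toFinset
  have hA : ∀ a, a ∈ A ↔ a ∈ innerProducts X := fun a => Set.Finite.mem_toFinset _
  have hAc : A.card = r + 1 := by rw [← hr, Set.ncard_eq_toFinset_card _ (finite_innerProducts X)]
  let B := A.erase (-1)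
  have hBc : B.card = r := by
    rw [Finset.card_erase_of_mem ((hA _).mpr (neg_one_mem_innerProducts hu hanti hne)), hAc]
    rfl
  have hB : ∀ a ∈ B, -a ∈ B := by
    intro a ha
    have h1 := Finset.mem_erase.mp ha
    have h2 := (hA a).mp h1.2
    refine Finset.mem_erase.mpr ⟨fun h => ?_, ?_⟩
    · rw [neg_inj.mp h] at h2
      exact one_notMem_innerProducts hu h2
    · rcases neg_mem_insert_innerProducts hu hanti hne (Or.inr h2) with h | h
      · exact absurd (neg_eq_iff_eq_neg.mp h) h1.1
      · exact (hA _).mpr h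
  have h1B : ∀ a ∈ B, (1 : ℝ) - a ≠ 0 := by
    intro a ha h
    rw [sub_eq_zero] at h
    refine one_notMem_innerProducts hu ?_
    rw [h]
    exact (hA a).mp (Finset.mem_erase.mp ha).2
  have hfac : ∀ a ∈ B, (C (1 - a)⁻¹ * (Polynomial.X - C a)).natDegree = 1 := fun a ha => by
    rw [natDegree_C_mul (inv_ne_zero (h1B a ha)), natDegree_X_sub_C]
  have hne0 : ∀ a ∈ B, C (1 - a)⁻¹ * (Polynomial.X - C a) ≠ 0 := fun a ha =>
    mul_ne_zero (C_ne_zero.mpr (inv_ne_zero (h1B a ha))) (X_sub_C_ne_zero a)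
  refine ⟨∏ a ∈ B, (C (1 - a)⁻¹ * (Polynomial.X - C a)), ?_, ?_, ?_, ?_, ?_⟩
  · rw [natDegree_prod _ _ hne0, Finset.sum_congr rfl hfac]
    simp [hBc]
  · exact Finset.prod_ne_zero_iff.mpr hne0
  · rw [eval_prod]
    refine Finset.prod_eq_one fun a ha => ?_
    simp [h1B a ha]
  · rw [eval_prod]
    have h1 : ∀ a ∈ B, (C (1 - a)⁻¹ * (Polynomial.X - C a)).eval (-1) =
        (-1) * ((1 - a)⁻¹ * (1 - -a)) := by
      intro a _
      simp only [eval_mul, eval_C, eval_sub, eval_X]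
      ring
    rw [Finset.prod_congr rfl h1, Finset.prod_mul_distrib, Finset.prod_const, hBc,
      Finset.prod_mul_distrib]
    -- A(X) without -1 is closed under negation, so the normalizing denominators cancel at -1 as
    -- they do at 1 and only the sign (-1)^r remains.
    have h2 : ∏ a ∈ B, (1 - -a) = ∏ a ∈ B, (1 - a) :=
      Finset.prod_bij (fun a _ => -a) (fun a ha => hB a ha) (fun a _ b _ h => neg_inj.mp h)
        (fun b hb => ⟨-b, hB b hb, neg_neg b⟩) fun a _ => rfl
    rw [h2, ← Finset.prod_mul_distrib, Finset.prod_congr rfl fun a ha => inv_mul_cancel₀ (h1B a ha)]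
    simp
  · intro a ha ha1
    rw [eval_prod]
    refine Finset.prod_eq_zero (i := a) (Finset.mem_erase.mpr ⟨ha1, (hA a).mpr ha⟩) ?_
    simp

/-- Polynomials `f_0, …, f_s` in the inner product which satisfy, on an antipodal design, the
composition law of reproducing kernels. -/
structure IsKernelSequence (X : Finset (EuclideanSpace ℝ (Fin n))) (s : ℕ) (f : ℕ → ℝ[X]) :
    Prop where
  natDegree_le : ∀ k ≤ s, (f k).natDegree ≤ k
  natDegree_eq : ∀ k ≤ s, s ≤ k + 1 → (f k).natDegree = k ∧ f k ≠ 0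
  zero : f 0 = 1
  eval_one : ∀ k, k + 2 ≤ s → (f k).eval 1 = (n + k - 1).choose k
  eval_inner : ∀ k ≤ s, s ≤ k + 1 → ∀ x ∈ X, ∀ y ∈ X, (f k).eval (inner ℝ x y) =
    X.card / 2 * ((if x = y then 1 else 0) + (-1) ^ k * (if x = -y then 1 else 0))
  eval_neg : ∀ k ≤ s, ∀ x ∈ X, ∀ y ∈ X,
    (f k).eval (-inner ℝ x y) = (-1) ^ k * (f k).eval (inner ℝ x y)
  sum_mul : ∀ k j, k + 2 * j ≤ s → ∀ x ∈ X, ∀ y ∈ X,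
    ∑ z ∈ X, (f k).eval (inner ℝ x z) * (f (k + 2 * j)).eval (inner ℝ z y) =
      X.card * (f k).eval (inner ℝ x y)

/-- The zonal kernels serve up to degree s-2, where all products have degree at most 2s-4 ≤ t. The
last two kernels are projections onto a parity class; they act as the identity on every kernel of
the same parity, so no design strength is needed for them. -/
theorem IsSphericalDesign.exists_isKernelSequence {t s : ℕ} (hX : IsSphericalDesign t X)
    (hanti : ∀ x ∈ X, -x ∈ X) (hs : (innerProducts X).ncard = s) (hst : 2 * s ≤ t + 3) :
    ∃ f : ℕ → ℝ[X], IsKernelSequence X s f := by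
  classical
  have hu := hX.2.1
  have hc0 : (X.card : ℝ) ≠ 0 := by exact_mod_cast hX.1.card_pos.ne'
  obtain ⟨r, rfl⟩ : ∃ r, s = r + 1 := by
    refine Nat.exists_eq_succ_of_ne_zero ?_
    rw [← hs]
    exact ((Set.ncard_pos (finite_innerProducts X)).mpr
      ⟨_, neg_one_mem_innerProducts hu hanti hX.1⟩).ne'
  have hN : ∃ (N : ℕ → ℝ[X])
      (κ : ℕ → EuclideanSpace ℝ (Fin n) → MvPolynomial (Fin n) ℝ),
      ∀ k < r, IsZonalKernel n k (N k) (κ k) := by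
    rcases Nat.eq_zero_or_pos r with rfl | hr
    -- For s = 1 no zonal kernel is needed; the dimension may then be 1, where the circle argument
    -- is unavailable.
    · exact ⟨fun _ => 0, fun _ _ => 0, by simp⟩
    · have hn : 2 ≤ n := two_le_dim_of_two_le_ncard hu (by omega)
      choose N κ h using fun k => exists_isZonalKernel hn k
      exact ⟨N, κ, fun k _ => h k⟩
  obtain ⟨N, κ, hN⟩ := hN
  obtain ⟨F, hFd, hF0, hF1, hFm, hFa⟩ := exists_antipodal_indicator hu hanti hX.1 hs
  let f : ℕ → ℝ[X] := fun k =>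
    -- F has degree r = s-1 and vanishes at all inner products other than 1 and -1; the factor X in
    -- the case k = s raises the degree by one and flips the sign at -1.
    if k < r then N k else C (X.card / 2 : ℝ) * (Polynomial.X ^ (k - r) * F)
  have hflt : ∀ k < r, f k = N k := fun k hk => if_pos hk
  have hfge : ∀ k, ¬ k < r → f k = C (X.card / 2 : ℝ) * (Polynomial.X ^ (k - r) * F) :=
    fun k hk => if_neg hk
  have hdeg : ∀ k ≤ r + 1, r + 1 ≤ k + 1 → (f k).natDegree = k ∧ f k ≠ 0 := by
    intro k hk hk'
    rw [hfge k (by omega)]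
    constructor
    · rw [natDegree_C_mul (by simpa using hX.1.ne_empty),
        natDegree_mul (pow_ne_zero _ X_ne_zero) hF0, natDegree_X_pow, hFd]
      omega
    · exact mul_ne_zero (C_ne_zero.mpr (by simpa using hX.1.ne_empty))
        (mul_ne_zero (pow_ne_zero _ X_ne_zero) hF0)
  have hinner : ∀ k ≤ r + 1, r + 1 ≤ k + 1 → ∀ x ∈ X, ∀ y ∈ X, (f k).eval (inner ℝ x y) =
      X.card / 2 * ((if x = y then 1 else 0) + (-1) ^ k * (if x = -y then 1 else 0)) := by
    intro k hk hk' x hx y hy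
    rw [hfge k (by omega)]
    simp only [eval_mul, eval_C, eval_pow, eval_X]
    congr 1
    by_cases h1 : x = y
    · subst h1
      rw [(inner_eq_one_iff_of_mem hu hx hx).mpr rfl]
      simp [hF1, ne_neg_self_of_mem hu hx]
    · by_cases h2 : x = -y
      · rw [(inner_eq_neg_one_iff_of_mem hu hx hy).mpr h2, hFm, ← pow_add, if_neg h1, if_pos h2,
          Nat.sub_add_cancel (by omega)]
        simp
      · rw [hFa _ ⟨x, hx, y, hy, h1, rfl⟩
          (fun h => h2 ((inner_eq_neg_one_iff_of_mem hu hx hy).mp h)), if_neg h1, if_neg h2]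
        simp
  have hneg : ∀ k ≤ r + 1, ∀ x ∈ X, ∀ y ∈ X,
      (f k).eval (-inner ℝ x y) = (-1) ^ k * (f k).eval (inner ℝ x y) := by
    intro k hk x hx y hy
    by_cases hkr : k < r
    · rw [hflt k hkr]
      refine (hN k hkr).eval_neg _ ?_
      have := abs_real_inner_le_norm x y
      rwa [hu x hx, hu y hy, one_mul] at this
    · rw [← inner_neg_right, hinner k hk (by omega) x hx _ (hanti y hy),
        hinner k hk (by omega) x hx y hy, neg_neg]
      have : ((-1 : ℝ) ^ k) * (-1) ^ k = 1 := by rw [← mul_pow]; simp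
      linear_combination (-(X.card / 2 : ℝ) * (if x = -y then 1 else 0)) * this
  refine ⟨f, ?_, hdeg, ?_, ?_, hinner, hneg, ?_⟩
  · intro k hk
    by_cases hkr : k < r
    · rw [hflt k hkr]
      exact (hN k hkr).natDegree_le
    · exact (hdeg k hk (by omega)).1.le
  · by_cases hr : 0 < r
    · rw [hflt 0 hr]
      have h0 := hN 0 hr
      have h1 := h0.eval_one
      rw [eq_C_of_natDegree_le_zero h0.natDegree_le] at h1 ⊢
      rw [eval_C] at h1
      rw [h1]
      simp
    -- Here s = 1, so X is a pair of antipodal points, |X|/2 = 1, and F is the constant 1.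
    · obtain rfl : r = 0 := by omega
      obtain ⟨a, ha⟩ := Set.ncard_eq_one.mp hs
      have h2 : X.card = 2 := by
        obtain ⟨x, hx⟩ := hX.1
        have : X = {x, -x} := by
          ext y
          simp only [Finset.mem_insert, Finset.mem_singleton]
          constructor
          · intro hy
            by_cases hxy : y = x
            · exact Or.inl hxy
            · right
              have h1 : inner ℝ y x ∈ innerProducts X := ⟨y, hy, x, hx, hxy, rfl⟩
              have h2 := neg_one_mem_innerProducts hu hanti hX.1
              rw [ha, Set.mem_singleton_iff] at h1 h2
              exact (inner_eq_neg_one_iff_of_mem hu hy hx).mp (h1.trans h2.symm)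
          · rintro (rfl | rfl)
            · exact hx
            · exact hanti x hx
        rw [this, Finset.card_pair (ne_neg_self_of_mem hu hx)]
      rw [hfge 0 (by omega), h2, eq_C_of_natDegree_eq_zero hFd]
      rw [eq_C_of_natDegree_eq_zero hFd, eval_C] at hF1
      rw [hF1]
      simp
  · intro k hk
    rw [hflt k (by omega)]
    exact (hN k (by omega)).eval_one
  · intro k j hkj x hx y hy
    by_cases hl : k + 2 * j < r
    · rw [hflt k (by omega), hflt _ hl]
      exact hX.sum_zonal_mul (hN k (by omega)) (hN _ hl) (by omega) hx hy
    -- The second kernel is supported on z = y and z = -y; by the parity of f_k both points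
    -- contribute the same amount.
    · have h1 : ∀ z ∈ X, (f k).eval (inner ℝ x z) * (f (k + 2 * j)).eval (inner ℝ z y) =
          X.card / 2 * ((if z = y then (f k).eval (inner ℝ x z) else 0) +
            (if z = -y then (-1) ^ k * (f k).eval (inner ℝ x z) else 0)) := by
        intro z hz
        rw [hinner _ hkj (by omega) z hz y hy, pow_add, pow_mul]
        split_ifs <;> simp <;> ring
      rw [Finset.sum_congr rfl h1, ← Finset.mul_sum, Finset.sum_add_distrib,
        Finset.sum_ite_eq' X y, if_pos hy, Finset.sum_ite_eq' X (-y), if_pos (hanti y hy),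
        inner_neg_right, hneg k (by omega) x hx y hy]
      have : ((-1 : ℝ) ^ k) * (-1) ^ k = 1 := by rw [← mul_pow]; simp
      linear_combination (X.card / 2 * (f k).eval (inner ℝ x y)) * this

/-- The substitution z ↦ -z changes the sign of the sum. -/
theorem sum_mul_eq_zero_of_parity (hanti : ∀ x ∈ X, -x ∈ X) {f g : ℝ[X]} {k l : ℕ}
    (hf : ∀ x ∈ X, ∀ y ∈ X, f.eval (-inner ℝ x y) = (-1) ^ k * f.eval (inner ℝ x y))
    (hg : ∀ x ∈ X, ∀ y ∈ X, g.eval (-inner ℝ x y) = (-1) ^ l * g.eval (inner ℝ x y))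
    (hkl : Odd (k + l)) {x y : EuclideanSpace ℝ (Fin n)} (hx : x ∈ X) (hy : y ∈ X) :
    ∑ z ∈ X, f.eval (inner ℝ x z) * g.eval (inner ℝ z y) = 0 := by
  have h : ∑ z ∈ X, f.eval (inner ℝ x z) * g.eval (inner ℝ z y) =
      ∑ z ∈ X, -(f.eval (inner ℝ x z) * g.eval (inner ℝ z y)) := by
    refine Finset.sum_bij (fun z _ => -z) hanti (fun a _ b _ h => neg_inj.mp h)
      (fun b hb => ⟨-b, hanti b hb, neg_neg b⟩) fun z hz => ?_
    rw [inner_neg_right, inner_neg_left, hf x hx z hz, hg z hz y hy]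
    have : ((-1 : ℝ) ^ k) * (-1) ^ l = -1 := by rw [← pow_add, hkl.neg_one_pow]
    linear_combination (f.eval (inner ℝ x z) * g.eval (inner ℝ z y)) * this
  rw [Finset.sum_neg_distrib] at h
  linarith

/-- By symmetry the inner products of distinct points are -1 and 0. The composition law for the
zonal kernel of degree 1, of degree 2 in z, evaluated at y = x reads 2n² = |X| n. -/
theorem IsSphericalDesign.card_eq_two_mul {t : ℕ} (hX : IsSphericalDesign t X)
    (hanti : ∀ x ∈ X, -x ∈ X) (hs : (innerProducts X).ncard = 2) (ht : 2 ≤ t) :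
    X.card = 2 * n := by
  classical
  have hu := hX.2.1
  have hn : 2 ≤ n := two_le_dim_of_two_le_ncard hu hs.ge
  obtain ⟨N, κ, hN⟩ := exists_isZonalKernel hn 1
  have h1 : N.eval 1 = n := by simpa using hN.eval_one
  have hm : N.eval (-1) = -n := by rw [hN.eval_neg 1 (by simp), h1]; simp
  have h0 : N.eval 0 = 0 := by
    have := hN.eval_neg 0 (by simp)
    simp only [neg_zero, pow_one] at this
    linarith
  obtain ⟨x, hx⟩ := hX.1
  have hzero : ∀ z ∈ X, z ≠ x → z ≠ -x → inner ℝ x z = (0 : ℝ) := by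
    intro z hz hzx hzx'
    obtain ⟨a, b, hab, hA⟩ := Set.ncard_eq_two.mp hs
    have hm1 := neg_one_mem_innerProducts hu hanti hX.1
    have hz1 : inner ℝ x z ∈ innerProducts X := ⟨x, hx, z, hz, hzx.symm, rfl⟩
    have hz2 : inner ℝ x (-z) ∈ innerProducts X :=
      ⟨x, hx, -z, hanti z hz, fun h => hzx' (by rw [h, neg_neg]), rfl⟩
    have hne1 : inner ℝ x z ≠ (-1 : ℝ) := fun h =>
      hzx' (by rw [(inner_eq_neg_one_iff_of_mem hu hx hz).mp h, neg_neg])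
    have hne2 : inner ℝ x (-z) ≠ (-1 : ℝ) := fun h =>
      hzx (by rw [(inner_eq_neg_one_iff_of_mem hu hx (hanti z hz)).mp h, neg_neg])
    rw [inner_neg_right] at hz2 hne2
    rw [hA] at hm1 hz1 hz2
    simp only [Set.mem_insert_iff, Set.mem_singleton_iff] at hm1 hz1 hz2
    rcases hm1 with h | h <;> rcases hz1 with h' | h' <;> rcases hz2 with h'' | h'' <;>
      first
      | linarith
      | exact absurd (by linarith) hne1
      | exact absurd (by linarith) hne2
  have hsum := hX.sum_zonal_mul (j := 0) hN hN (by omega) hx hx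
  have hterm : ∀ z ∈ X, N.eval (inner ℝ x z) * N.eval (inner ℝ z x) =
      (if z = x then (n : ℝ) ^ 2 else 0) + (if z = -x then (n : ℝ) ^ 2 else 0) := by
    intro z hz
    rw [real_inner_comm x z]
    by_cases hzx : z = x
    · subst hzx
      rw [(inner_eq_one_iff_of_mem hu hx hx).mpr rfl, h1, if_pos rfl,
        if_neg (ne_neg_self_of_mem hu hx)]
      ring
    · by_cases hzx' : z = -x
      · rw [(inner_eq_neg_one_iff_of_mem hu hx hz).mpr (by rw [hzx', neg_neg]), hm, if_neg hzx,
          if_pos hzx']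
        ring
      · rw [hzero z hz hzx hzx', h0, if_neg hzx, if_neg hzx']
        ring
  rw [Finset.sum_congr rfl hterm, Finset.sum_add_distrib, Finset.sum_ite_eq' X x, if_pos hx,
    Finset.sum_ite_eq' X (-x), if_pos (hanti x hx),
    (inner_eq_one_iff_of_mem hu hx hx).mpr rfl, h1] at hsum
  have hn0 : (n : ℝ) ≠ 0 := by positivity
  have : (X.card : ℝ) = 2 * n := mul_right_cancel₀ hn0 (by linarith)
  exact_mod_cast this

end AntipodalSphericalSet

/-! ### Association schemes from orthogonal idempotents -/

section SpectralScheme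

variable {V : Type*} [Fintype V] {d : ℕ}

/-- A symmetric function `c` on `V × V` with values `α 0, …, α d`, together with `d + 1` nonzero
orthogonal idempotent matrices whose entries are functions of the values of `c`. -/
structure IsSpectralFamily (c : V → V → ℝ) (α : Fin (d + 1) → ℝ) (w : Fin (d + 1) → ℝ → ℝ)
    (E : Fin (d + 1) → Matrix V V ℝ) : Prop where
  symm : ∀ x y, c x y = c y x
  injective : Function.Injective α
  cover : ∀ x y, ∃ i, c x y = α i
  attained : ∀ i, ∃ x y, c x y = α i
  diagonal : ∀ x y, c x y = α 0 ↔ x = y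
  entry : ∀ i x y, E i x y = w i (c x y)
  mul : ∀ i j, E i * E j = if i = j then E i else 0
  ne_zero : ∀ i, E i ≠ 0

theorem eq_sum_ite_smul {ι M : Type*} [Fintype ι] [DecidableEq ι] [AddCommGroup M] [Module ℝ M]
    (E : ι → M) (i : ι) : E i = ∑ j, (if j = i then (1 : ℝ) else 0) • E j := by
  simp

theorem Matrix.rank_eq_trace_of_mul_self [DecidableEq V] {M : Matrix V V ℝ} (h : M * M = M) :
    (M.rank : ℝ) = M.trace := by
  have h1 : IsIdempotentElem (Matrix.toLin' M) := by
    rw [IsIdempotentElem, Module.End.mul_eq_comp, ← Matrix.toLin'_mul, h]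
  have h2 := (LinearMap.IsIdempotentElem.isProj_range _ h1).trace
  rw [Matrix.trace_toLin'_eq] at h2
  rw [h2, Matrix.rank_eq_finrank_range_toLin M (Pi.basisFun ℝ V) (Pi.basisFun ℝ V)]
  rfl

namespace IsSpectralFamily

variable {c : V → V → ℝ} {α : Fin (d + 1) → ℝ} {w : Fin (d + 1) → ℝ → ℝ}
  {E : Fin (d + 1) → Matrix V V ℝ} (h : IsSpectralFamily c α w E)

include h

theorem sum_smul_mul (a : Fin (d + 1) → ℝ) (j : Fin (d + 1)) :
    (∑ i, a i • E i) * E j = a j • E j := by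
  rw [Finset.sum_mul, Finset.sum_eq_single j]
  · rw [Matrix.smul_mul, h.mul, if_pos rfl]
  · intro i _ hij
    rw [Matrix.smul_mul, h.mul, if_neg hij, smul_zero]
  · simp

theorem sum_smul_mul_sum_smul (a b : Fin (d + 1) → ℝ) :
    (∑ i, a i • E i) * (∑ i, b i • E i) = ∑ i, (a i * b i) • E i := by
  rw [Finset.mul_sum]
  refine Finset.sum_congr rfl fun j _ => ?_
  rw [Matrix.mul_smul, h.sum_smul_mul, smul_smul, mul_comm]

theorem coeff_unique {a b : Fin (d + 1) → ℝ} (hab : ∑ i, a i • E i = ∑ i, b i • E i) : a = b := by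
  ext j
  have h1 := congrArg (· * E j) hab
  simp only [h.sum_smul_mul] at h1
  exact smul_left_injective ℝ (h.ne_zero j) h1

theorem sum_smul_apply (a : Fin (d + 1) → ℝ) (x y : V) :
    (∑ i, a i • E i) x y = ∑ i, a i * w i (c x y) := by
  simp [Matrix.sum_apply, h.entry]

/-- Every matrix whose entries are a function of `c` is a combination of the idempotents. -/
theorem exists_coeff (g : ℝ → ℝ) :
    ∃ a : Fin (d + 1) → ℝ, Matrix.of (fun x y => g (c x y)) = ∑ i, a i • E i := by
  -- `Φ` sends coefficients to the values of the combination at the d + 1 values of c. Independence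
  -- of the idempotents makes it injective, and equality of dimensions makes it surjective.
  let Φ : (Fin (d + 1) → ℝ) →ₗ[ℝ] (Fin (d + 1) → ℝ) :=
    { toFun a j := ∑ i, a i * w i (α j)
      map_add' a b := by ext j; simp [add_mul, Finset.sum_add_distrib]
      map_smul' r a := by ext j; simp [Finset.mul_sum, mul_assoc] }
  have hinj : Function.Injective Φ := by
    intro a b hab
    refine h.coeff_unique ?_
    ext x y
    obtain ⟨j, hj⟩ := h.cover x y
    rw [h.sum_smul_apply, h.sum_smul_apply, hj]
    exact congrFun hab j
  obtain ⟨a, ha⟩ := LinearMap.injective_iff_surjective.mp hinj fun j => g (α j)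
  refine ⟨a, ?_⟩
  ext x y
  obtain ⟨j, hj⟩ := h.cover x y
  rw [h.sum_smul_apply, Matrix.of_apply, hj]
  exact (congrFun ha j).symm

/-- The count is an entry of the product of two indicator matrices. Both are combinations of the
idempotents, hence so is the product, and its entries depend only on c. -/
theorem natCard_eq_of_eq (i j : Fin (d + 1)) {x y x' y' : V} (hxy : c x y = c x' y') :
    Nat.card {z : V // c x z = α i ∧ c z y = α j} =
      Nat.card {z : V // c x' z = α i ∧ c z y' = α j} := by
  classical
  obtain ⟨a, ha⟩ := h.exists_coeff fun r => if r = α i then 1 else 0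
  obtain ⟨b, hb⟩ := h.exists_coeff fun r => if r = α j then 1 else 0
  have key : ∀ x y : V, ((Nat.card {z : V // c x z = α i ∧ c z y = α j} : ℕ) : ℝ) =
      ∑ k, (a k * b k) * w k (c x y) := by
    intro x y
    rw [← h.sum_smul_apply, ← h.sum_smul_mul_sum_smul, ← ha, ← hb, Matrix.mul_apply,
      Nat.card_eq_fintype_card, Fintype.card_subtype, Finset.card_filter, Nat.cast_sum]
    refine Finset.sum_congr rfl fun z _ => ?_
    by_cases h1 : c x z = α i <;> by_cases h2 : c z y = α j <;> simp [h1, h2]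
  have := (key x y).trans (hxy ▸ (key x' y').symm)
  exact_mod_cast this

end IsSpectralFamily

/-- The association scheme of a spectral family. -/
def IsSpectralFamily.scheme {c : V → V → ℝ} {α : Fin (d + 1) → ℝ} {w : Fin (d + 1) → ℝ → ℝ}
    {E : Fin (d + 1) → Matrix V V ℝ} (h : IsSpectralFamily c α w E) : AssociationScheme V d where
  rel i x y := c x y = α i
  rel_zero := h.diagonal
  existsUnique_rel x y := by
    obtain ⟨i, hi⟩ := h.cover x y
    exact ⟨i, hi, fun j hj => h.injective (hj.symm.trans hi)⟩
  rel_nonempty := h.attained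
  rel_symm i x y hxy := (h.symm y x).trans hxy
  exists_intersectionNumber i j k := by
    obtain ⟨x₀, y₀, h₀⟩ := h.attained k
    exact ⟨_, fun x y hxy => h.natCard_eq_of_eq i j (hxy.trans h₀.symm)⟩

namespace IsSpectralFamily

variable {c : V → V → ℝ} {α : Fin (d + 1) → ℝ} {w : Fin (d + 1) → ℝ → ℝ}
  {E : Fin (d + 1) → Matrix V V ℝ} (h : IsSpectralFamily c α w E)

include h

open scoped Classical in
theorem scheme_adj (i : Fin (d + 1)) :
    h.scheme.adj i = Matrix.of fun x y => if c x y = α i then 1 else 0 := rfl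

theorem eq_sum_adj (g : ℝ → ℝ) :
    Matrix.of (fun x y => g (c x y)) = ∑ i, g (α i) • h.scheme.adj i := by
  classical
  ext x y
  obtain ⟨j, hj⟩ := h.cover x y
  simp [Matrix.sum_apply, h.scheme_adj, hj, h.injective.eq_iff]

theorem mem_boseMesner_iff (M : Matrix V V ℝ) :
    M ∈ h.scheme.boseMesner ↔ ∃ a : Fin (d + 1) → ℝ, M = ∑ i, a i • E i := by
  classical
  constructor
  · intro hM
    have hle : h.scheme.boseMesner ≤ Submodule.span ℝ (Set.range E) := by
      refine Submodule.span_le.mpr ?_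
      rintro _ ⟨i, rfl⟩
      obtain ⟨a, ha⟩ := h.exists_coeff fun r => if r = α i then 1 else 0
      rw [h.scheme_adj, ha]
      exact Submodule.sum_mem _ fun j _ =>
        Submodule.smul_mem _ _ (Submodule.subset_span ⟨j, rfl⟩)
    obtain ⟨a, ha⟩ := (Submodule.mem_span_range_iff_exists_fun ℝ).mp (hle hM)
    exact ⟨a, ha.symm⟩
  · rintro ⟨a, rfl⟩
    refine Submodule.sum_mem _ fun i _ => Submodule.smul_mem _ _ ?_
    have : E i = Matrix.of (fun x y => w i (c x y)) := by ext x y; exact h.entry i x y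
    rw [this, h.eq_sum_adj]
    exact Submodule.sum_mem _ fun j _ => Submodule.smul_mem _ _ (Submodule.subset_span ⟨j, rfl⟩)

/-- By orthogonality, the idempotents of the algebra are the combinations with coefficients 0 and 1.
Any such combination that involves E_i splits as E_i plus an orthogonal rest. -/
theorem isPrimitiveIdempotent_iff (e : Matrix V V ℝ) :
    h.scheme.IsPrimitiveIdempotent e ↔ ∃ i, E i = e := by
  have hmem : ∀ i, E i ∈ h.scheme.boseMesner := fun i =>
    (h.mem_boseMesner_iff _).mpr ⟨_, eq_sum_ite_smul E i⟩
  have hidem : ∀ a : Fin (d + 1) → ℝ,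
      (∑ i, a i • E i) * (∑ i, a i • E i) = ∑ i, a i • E i → ∀ i, a i = 0 ∨ a i = 1 := by
    intro a ha i
    rw [h.sum_smul_mul_sum_smul] at ha
    have := congrFun (h.coeff_unique ha) i
    rcases eq_or_ne (a i) 0 with h0 | h0
    · exact Or.inl h0
    · exact Or.inr (mul_left_cancel₀ h0 (by rw [mul_one]; exact this))
  constructor
  · rintro ⟨he, he0, hee, hprim⟩
    obtain ⟨a, rfl⟩ := (h.mem_boseMesner_iff _).mp he
    have ha := hidem a hee
    obtain ⟨i, hi⟩ : ∃ i, a i ≠ 0 := by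
      by_contra! hall
      exact he0 (Finset.sum_eq_zero fun i _ => by rw [hall i, zero_smul])
    have hi1 : a i = 1 := (ha i).resolve_left hi
    refine ⟨i, ?_⟩
    set e := ∑ i, a i • E i with hedef
    have hEe : E i * e = E i := by
      rw [hedef, eq_sum_ite_smul E i, h.sum_smul_mul_sum_smul, ← eq_sum_ite_smul E i]
      conv_rhs => rw [eq_sum_ite_smul E i]
      refine Finset.sum_congr rfl fun j _ => ?_
      split_ifs with hj
      · rw [hj, hi1, mul_one]
      · rw [zero_mul]
    have heE : e * E i = E i := by rw [hedef, h.sum_smul_mul, hi1, one_smul]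
    have hEE : E i * E i = E i := by rw [h.mul, if_pos rfl]
    have := hprim (E i) (hmem i) (e - E i) (Submodule.sub_mem _ he (hmem i)) hEE
      (by rw [sub_mul, mul_sub, mul_sub, hee, hEe, heE, hEE]; abel)
      (by rw [mul_sub, hEe, hEE, sub_self]) (by rw [sub_mul, heE, hEE, sub_self]) (by abel)
    rcases this with h0 | h0
    · exact absurd h0 (h.ne_zero i)
    · exact (sub_eq_zero.mp h0).symm
  · rintro ⟨i, rfl⟩
    refine ⟨hmem i, h.ne_zero i, by rw [h.mul, if_pos rfl], ?_⟩
    intro f hf g hg hff hgg hfg _ hsum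
    obtain ⟨a, rfl⟩ := (h.mem_boseMesner_iff _).mp hf
    obtain ⟨b, rfl⟩ := (h.mem_boseMesner_iff _).mp hg
    have ha := hidem a hff
    have hb := hidem b hgg
    rw [eq_sum_ite_smul E i, ← Finset.sum_add_distrib] at hsum
    simp only [← add_smul] at hsum
    have hab := h.coeff_unique hsum
    have hoff : ∀ j, j ≠ i → a j = 0 ∧ b j = 0 := by
      intro j hj
      have h1 := congrFun hab j
      simp only [if_neg hj] at h1
      rcases ha j with h2 | h2 <;> rcases hb j with h3 | h3 <;> rw [h2, h3] at h1 <;>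
        norm_num at h1
      exact ⟨h2, h3⟩
    have h1 := congrFun hab i
    simp only [if_true] at h1
    rcases ha i with h2 | h2
    · left
      refine Finset.sum_eq_zero fun j _ => ?_
      by_cases hj : j = i
      · rw [hj, h2, zero_smul]
      · rw [(hoff j hj).1, zero_smul]
    · right
      refine Finset.sum_eq_zero fun j _ => ?_
      by_cases hj : j = i
      · rw [hj, show b i = 0 by linarith, zero_smul]
      · rw [(hoff j hj).2, zero_smul]

theorem isIdempotentOrdering
    (h0 : E 0 = (Fintype.card V : ℝ)⁻¹ • Matrix.of fun _ _ => (1 : ℝ)) :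
    h.scheme.IsIdempotentOrdering E where
  injective i j hij := by
    by_contra hne
    have h1 := h.mul i j
    rw [if_neg hne, ← hij, h.mul, if_pos rfl] at h1
    exact h.ne_zero i h1
  range_eq := by
    ext e
    exact (h.isPrimitiveIdempotent_iff e).symm
  zero_eq := h0

theorem exists_isFirstEigenmatrix : ∃ P, h.scheme.IsFirstEigenmatrix E P := by
  classical
  choose P hP using fun j => h.exists_coeff fun r => if r = α j then 1 else 0
  exact ⟨P, fun j => (h.scheme_adj j).trans (hP j)⟩

theorem isSecondEigenmatrix :
    h.scheme.IsSecondEigenmatrix E fun j i => Fintype.card V * w j (α i) := by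
  intro j
  rw [← h.eq_sum_adj fun r => Fintype.card V * w j r]
  ext x y
  simp [h.entry]

theorem exists_isKreinNumbers [Nonempty V] : ∃ q, IsKreinNumbers E q := by
  have hc : (Fintype.card V : ℝ) ≠ 0 := by exact_mod_cast Fintype.card_ne_zero
  choose a ha using fun i j => h.exists_coeff fun r => w i r * w j r
  refine ⟨fun i j k => Fintype.card V * a i j k, fun i j => ?_⟩
  have h1 : ((Fintype.card V : ℝ) • E i) ⊙ ((Fintype.card V : ℝ) • E j) =
      ((Fintype.card V : ℝ) * Fintype.card V) • ∑ k, a i j k • E k := by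
    rw [← ha]
    ext x y
    simp only [Matrix.hadamard_apply, Matrix.smul_apply, smul_eq_mul, Matrix.of_apply, h.entry]
    ring
  rw [h1, Finset.smul_sum]
  refine Finset.sum_congr rfl fun k _ => ?_
  rw [smul_smul, smul_smul]
  congr 1
  ring

theorem rank_eq (i : Fin (d + 1)) : ((E i).rank : ℝ) = Fintype.card V * w i (α 0) := by
  classical
  rw [Matrix.rank_eq_trace_of_mul_self (by rw [h.mul, if_pos rfl]), Matrix.trace]
  have : ∀ x : V, (E i).diag x = w i (α 0) := fun x => by
    rw [Matrix.diag_apply, h.entry, (h.diagonal x x).mpr rfl]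
  rw [Finset.sum_congr rfl fun x _ => this x]
  simp

end IsSpectralFamily

end SpectralScheme

/-! ### Krein numbers, degrees and the dual intersection matrix -/

section KreinNumbers

open Polynomial

variable {V : Type*} [Fintype V] {d : ℕ} {c : V → V → ℝ} {α : Fin (d + 1) → ℝ}
  {v : ℕ → ℝ[X]} {E : Fin (d + 1) → Matrix V V ℝ}
  {q : Fin (d + 1) → Fin (d + 1) → Fin (d + 1) → ℝ}

namespace IsSpectralFamily

variable [Nonempty V]
  (h : IsSpectralFamily c α (fun i r => (Fintype.card V : ℝ)⁻¹ * (v i).eval r) E)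

include h

theorem eval_eq (i : Fin (d + 1)) (x y : V) :
    (v i).eval (c x y) = Fintype.card V * E i x y := by
  have hc : (Fintype.card V : ℝ) ≠ 0 := by exact_mod_cast Fintype.card_ne_zero
  rw [h.entry, mul_inv_cancel_left₀ hc]

theorem eval_coeff_unique {a b : Fin (d + 1) → ℝ}
    (hab : ∀ x y, ∑ i, a i * (v i).eval (c x y) = ∑ i, b i * (v i).eval (c x y)) : a = b := by
  have hc : (Fintype.card V : ℝ) ≠ 0 := by exact_mod_cast Fintype.card_ne_zero
  refine h.coeff_unique ?_
  ext x y
  have h1 := hab x y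
  simp only [h.eval_eq] at h1
  simp only [Matrix.sum_apply, Matrix.smul_apply, smul_eq_mul]
  refine mul_left_cancel₀ hc ?_
  rw [Finset.mul_sum, Finset.mul_sum]
  convert h1 using 2 <;> ring

theorem eval_mul_eval (hq : IsKreinNumbers E q) (i j : Fin (d + 1)) (x y : V) :
    (v i).eval (c x y) * (v j).eval (c x y) = ∑ k, q i j k * (v k).eval (c x y) := by
  have h1 := congrFun (congrFun (hq i j) x) y
  simp only [Matrix.hadamard_apply, Matrix.sum_apply, Matrix.smul_apply, smul_eq_mul] at h1
  simp only [h.eval_eq]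
  exact h1

/-- By symmetry of c the double sum is |V|² times the trace of E_i E_j. -/
theorem sum_eval_mul_eval (i j : Fin (d + 1)) :
    ∑ x, ∑ y, (v i).eval (c x y) * (v j).eval (c x y) =
      if i = j then (Fintype.card V : ℝ) ^ 2 * (v i).eval (α 0) else 0 := by
  have hc : (Fintype.card V : ℝ) ≠ 0 := by exact_mod_cast Fintype.card_ne_zero
  have h1 : ∀ x, ∑ y, (v i).eval (c x y) * (v j).eval (c x y) =
      (Fintype.card V : ℝ) ^ 2 * (E i * E j) x x := by
    intro x
    rw [Matrix.mul_apply, Finset.mul_sum]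
    refine Finset.sum_congr rfl fun y _ => ?_
    rw [h.eval_eq, h.eval_eq, h.entry j x y, h.symm x y, ← h.entry j y x]
    ring
  rw [Finset.sum_congr rfl fun x _ => h1 x, ← Finset.mul_sum, h.mul]
  split_ifs with hij
  · congr 1
    have h2 : ∀ x, E i x x = (Fintype.card V : ℝ)⁻¹ * (v i).eval (α 0) := fun x => by
      rw [h.entry, (h.diagonal x x).mpr rfl]
    rw [Finset.sum_congr rfl fun x _ => h2 x]
    simp [hc]
  · simp

theorem eval_diagonal_ne_zero (i : Fin (d + 1)) : (v i).eval (α 0) ≠ 0 := by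
  intro h0
  have h1 := h.sum_eval_mul_eval i i
  rw [if_pos rfl, h0, mul_zero,
    Finset.sum_eq_zero_iff_of_nonneg fun x _ => Finset.sum_nonneg fun y _ => mul_self_nonneg _] at h1
  refine h.ne_zero i ?_
  ext x y
  have h2 := (Finset.sum_eq_zero_iff_of_nonneg fun y _ => mul_self_nonneg _).mp
    (h1 x (Finset.mem_univ x)) y (Finset.mem_univ y)
  rw [h.entry, mul_self_eq_zero.mp h2, mul_zero, Matrix.zero_apply]

/-- The numbers `m_k q_{i,j}^k` are symmetric in `j` and `k`. -/
theorem multiplicity_mul_krein (hq : IsKreinNumbers E q) (i j k : Fin (d + 1)) :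
    (v k).eval (α 0) * q i j k = (v j).eval (α 0) * q i k j := by
  have hc : (Fintype.card V : ℝ) ≠ 0 := by exact_mod_cast Fintype.card_ne_zero
  -- Orthogonality extracts the coefficient of v_k from the triple sum, and the triple sum is
  -- symmetric in j and k.
  have key : ∀ j k : Fin (d + 1), ∑ x, ∑ y, (v i).eval (c x y) * (v j).eval (c x y) * (v k).eval (c x y) =
      (Fintype.card V : ℝ) ^ 2 * ((v k).eval (α 0) * q i j k) := by
    intro j k
    simp only [h.eval_mul_eval hq i j, Finset.sum_mul]
    have h1 : ∀ x, ∑ y, ∑ l, q i j l * (v l).eval (c x y) * (v k).eval (c x y) =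
        ∑ l, q i j l * ∑ y, (v l).eval (c x y) * (v k).eval (c x y) := by
      intro x
      rw [Finset.sum_comm]
      refine Finset.sum_congr rfl fun l _ => ?_
      rw [Finset.mul_sum]
      exact Finset.sum_congr rfl fun y _ => mul_assoc _ _ _
    rw [Finset.sum_congr rfl fun x _ => h1 x, Finset.sum_comm]
    simp only [← Finset.mul_sum, h.sum_eval_mul_eval]
    simp
    ring
  have h1 := key j k
  have h2 := key k j
  have h3 : ∀ x y, (v i).eval (c x y) * (v j).eval (c x y) * (v k).eval (c x y) =
      (v i).eval (c x y) * (v k).eval (c x y) * (v j).eval (c x y) := fun x y => by ring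
  simp only [h3] at h1
  exact mul_left_cancel₀ (pow_ne_zero 2 hc) (h1.symm.trans h2)

/-- The idempotents add up to the identity matrix: it lies in their span, and multiplying by E_j
shows that each coefficient is 1. -/
theorem sum_eval (x y : V) :
    ∑ i : Fin (d + 1), (v i).eval (c x y) =
      Fintype.card V * (if c x y = α 0 then 1 else 0) := by
  classical
  obtain ⟨a, ha⟩ := h.exists_coeff fun r => if r = α 0 then 1 else 0
  have h1 : (1 : Matrix V V ℝ) = ∑ i, a i • E i := by
    rw [← ha]
    ext x y
    simp [Matrix.one_apply, h.diagonal]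
  have h2 : ∀ j, a j = 1 := by
    intro j
    have := h.sum_smul_mul a j
    rw [← h1, one_mul] at this
    exact (smul_left_injective ℝ (h.ne_zero j) (by simpa using this)).symm
  have h3 := congrFun (congrFun ha x) y
  simp only [h2, one_smul, Matrix.of_apply, Matrix.sum_apply] at h3
  rw [h3, Finset.mul_sum]
  exact Finset.sum_congr rfl fun i _ => h.eval_eq i x y

/-- Multiply v_i by the sum of all v_j. That sum is supported on the diagonal, where v_i is
constant. -/
theorem sum_krein (hq : IsKreinNumbers E q) (i k : Fin (d + 1)) :
    ∑ j, q i j k = (v i).eval (α 0) := by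
  have : (fun k => ∑ j, q i j k) = fun _ => (v i).eval (α 0) := by
    refine h.eval_coeff_unique fun x y => ?_
    have h1 : ∑ k, (∑ j, q i j k) * (v k).eval (c x y) =
        (v i).eval (c x y) * ∑ j : Fin (d + 1), (v j).eval (c x y) := by
      rw [Finset.mul_sum, Finset.sum_congr rfl fun j _ => h.eval_mul_eval hq i j x y,
        Finset.sum_comm]
      exact Finset.sum_congr rfl fun k _ => Finset.sum_mul _ _ _
    rw [h1, ← Finset.mul_sum, h.sum_eval]
    split_ifs with h0
    · rw [h0]
    · simp
  exact congrFun this k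

/-- Expanding v_i v_j at a pair where every v_k changes by (-1)^k shows that q_{i,j}^k and
(-1)^{i+j+k} q_{i,j}^k are coefficients of the same function. -/
theorem krein_eq_zero_of_odd (hq : IsKreinNumbers E q)
    (hpar : ∀ x y, ∃ x' y', ∀ i : Fin (d + 1),
      (v i).eval (c x' y') = (-1) ^ (i : ℕ) * (v i).eval (c x y))
    (i j k : Fin (d + 1)) (hodd : Odd ((i : ℕ) + j + k)) : q i j k = 0 := by
  have : (fun k : Fin (d + 1) => (-1) ^ ((i : ℕ) + j + k) * q i j k) = q i j := by
    refine h.eval_coeff_unique fun x y => ?_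
    obtain ⟨x', y', hxy⟩ := hpar x y
    have h1 := h.eval_mul_eval hq i j x' y'
    rw [← h.eval_mul_eval hq i j x y]
    simp only [hxy] at h1
    have h2 : ((-1 : ℝ) ^ ((i : ℕ) + j)) * (-1) ^ ((i : ℕ) + j) = 1 := by
      rw [← mul_pow]; simp
    calc ∑ k : Fin (d + 1), (-1) ^ ((i : ℕ) + j + k) * q i j k * (v k).eval (c x y)
        = (-1) ^ ((i : ℕ) + j) *
          ∑ k : Fin (d + 1), q i j k * ((-1) ^ (k : ℕ) * (v k).eval (c x y)) := by
          rw [Finset.mul_sum]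
          refine Finset.sum_congr rfl fun k _ => ?_
          rw [pow_add]
          ring
      _ = (v i).eval (c x y) * (v j).eval (c x y) := by
          rw [← h1]
          have h3 := pow_add (-1 : ℝ) i j
          linear_combination ((v i).eval (c x y) * (v j).eval (c x y)) * h2 -
            ((-1 : ℝ) ^ ((i : ℕ) + j) * (v i).eval (c x y) * (v j).eval (c x y)) * h3
  have h1 := congrFun this k
  simp only [hodd.neg_one_pow] at h1
  linarith

variable (hdeg : ∀ i ≤ d, (v i).natDegree ≤ i)

include hdeg

/-- If the degree dropped, v_0, …, v_i would be i + 1 polynomials in the i-dimensional space of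
degree less than i, yet they are independent even as functions on the values of c. -/
theorem degree_eq (i : ℕ) (hi : i ≤ d) : (v i).degree = i := by
  refine le_antisymm (natDegree_le_iff_degree_le.mp (hdeg i hi)) ?_
  by_contra! hlt
  have hmem : ∀ j : Fin (i + 1), v j ∈ degreeLT ℝ i := by
    intro j
    rw [mem_degreeLT]
    rcases (Nat.lt_succ_iff.mp j.2).lt_or_eq with hj | hj
    · refine (natDegree_le_iff_degree_le.mp (hdeg j (hj.le.trans hi))).trans_lt ?_
      exact_mod_cast hj
    · rw [hj]
      exact hlt
  have hli : LinearIndependent ℝ fun j : Fin (i + 1) => (⟨v j, hmem j⟩ : degreeLT ℝ i) := by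
    rw [Fintype.linearIndependent_iff]
    intro a ha
    let b : Fin (d + 1) → ℝ := fun k => if hk : (k : ℕ) < i + 1 then a ⟨k, hk⟩ else 0
    have h0 : b = 0 := by
      refine h.eval_coeff_unique fun x y => ?_
      have h1 := congrArg (fun p : degreeLT ℝ i => (p : ℝ[X]).eval (c x y)) ha
      simp only [Submodule.coe_sum, Submodule.coe_smul, eval_finsetSum, eval_smul, smul_eq_mul,
        ZeroMemClass.coe_zero, eval_zero] at h1
      simp only [Pi.zero_apply, zero_mul, Finset.sum_const_zero]
      rw [← h1]
      symm
      refine Finset.sum_of_injOn (Fin.castLE (by omega)) (Fin.castLE_injective _).injOn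
        (fun _ _ => Finset.mem_coe.mpr (Finset.mem_univ _)) ?_ ?_
      · intro k _ hk
        have : ¬ (k : ℕ) < i + 1 := fun hlt => hk ⟨⟨k, hlt⟩, by simp, by ext; simp⟩
        simp only [b, dif_neg this, zero_mul]
      · intro j _
        simp only [b, Fin.val_castLE, dif_pos j.2]
    intro j
    have h1 := congrFun h0 (Fin.castLE (by omega) j)
    simp only [b, Fin.val_castLE, dif_pos j.2] at h1
    exact h1
  have h1 := hli.fintype_card_le_finrank
  rw [(degreeLTEquiv ℝ i).finrank_eq] at h1
  simp at h1

theorem exists_coeff_of_natDegree_le (m : ℕ) (hm : m ≤ d) (p : ℝ[X]) (hp : p.natDegree ≤ m) :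
    ∃ a : Fin (d + 1) → ℝ, (∀ i : Fin (d + 1), m < i → a i = 0) ∧
      ∀ r, p.eval r = ∑ i, a i * (v i).eval r := by
  induction m generalizing p with
  | zero =>
    have h0 := h.degree_eq hdeg 0 (Nat.zero_le d)
    have h1 := eq_C_of_degree_eq_zero (by exact_mod_cast h0)
    have h2 : (v 0).coeff 0 ≠ 0 := by
      intro h3
      rw [h1, h3] at h0
      simp at h0
    refine ⟨fun i => if i = 0 then p.coeff 0 / (v 0).coeff 0 else 0, fun i hi => ?_, fun r => ?_⟩
    · refine if_neg ?_
      rintro rfl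
      simp at hi
    · rw [Finset.sum_eq_single 0 (by intro b _ hb; simp [hb]) (by simp),
        eq_C_of_natDegree_le_zero hp]
      simp only [if_true, Fin.val_zero]
      conv_rhs => rw [h1]
      simp [h2]
  | succ m ih =>
    have h0 := h.degree_eq hdeg (m + 1) hm
    have hnat : (v (m + 1)).natDegree = m + 1 := natDegree_eq_of_degree_eq_some h0
    have h2 : (v (m + 1)).coeff (m + 1) ≠ 0 := by
      have : v (m + 1) ≠ 0 := by
        intro h3
        rw [h3, degree_zero] at h0
        exact absurd h0.symm (WithBot.natCast_ne_bot _)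
      have h4 := leadingCoeff_ne_zero.mpr this
      rwa [leadingCoeff, hnat] at h4
    set e := p.coeff (m + 1) / (v (m + 1)).coeff (m + 1) with he
    obtain ⟨a, ha, hpa⟩ := ih (by omega) (p - C e * v (m + 1)) (by
      refine natDegree_le_iff_coeff_eq_zero.mpr fun N hN => ?_
      rw [coeff_sub, coeff_C_mul]
      rcases Nat.lt_or_eq_of_le (Nat.succ_le_of_lt hN) with hlt | heq
      · rw [coeff_eq_zero_of_natDegree_lt (hp.trans_lt hlt),
          coeff_eq_zero_of_natDegree_lt (hnat.le.trans_lt hlt)]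
        simp
      · rw [← heq, he]
        change p.coeff (m + 1) - _ = 0
        rw [Nat.succ_eq_add_one, div_mul_cancel₀ _ h2, sub_self])
    let k₀ : Fin (d + 1) := ⟨m + 1, by omega⟩
    refine ⟨fun i => a i + if i = k₀ then e else 0, fun i hi => ?_, fun r => ?_⟩
    · change a i + (if i = k₀ then e else 0) = 0
      rw [ha i (by omega), if_neg, add_zero]
      rintro rfl
      simp [k₀] at hi
    · have h3 := hpa r
      simp only [add_mul, Finset.sum_add_distrib, ← h3, ite_mul, zero_mul, Finset.sum_ite_eq',
        Finset.mem_univ, if_true]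
      simp [k₀]

theorem krein_one_eq_zero_of_lt (hq : IsKreinNumbers E q) {o i j : Fin (d + 1)}
    (ho : (o : ℕ) = 1) (hij : (i : ℕ) + 1 < j) : q o i j = 0 := by
  obtain ⟨a, ha, hva⟩ := h.exists_coeff_of_natDegree_le hdeg (i + 1) (by omega) (v o * v i) (by
    refine natDegree_mul_le.trans ?_
    have h1 := hdeg o (by omega)
    have h2 := hdeg i (by omega)
    omega)
  have : q o i = a := by
    refine h.eval_coeff_unique fun x y => ?_
    rw [← h.eval_mul_eval hq, ← hva, eval_mul]
  rw [this, ha j hij]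

/-- Above the diagonals the degree of v_1 v_i is too small, on the main diagonal 1 + 2i is odd, and
below it the symmetry of m_j q_{1,i}^j in i and j reduces to the first case. -/
theorem krein_one_eq_zero (hq : IsKreinNumbers E q)
    (hpar : ∀ x y, ∃ x' y', ∀ i : Fin (d + 1),
      (v i).eval (c x' y') = (-1) ^ (i : ℕ) * (v i).eval (c x y))
    {o i j : Fin (d + 1)} (ho : (o : ℕ) = 1) (hij : (i : ℕ) + 1 ≠ j) (hji : (j : ℕ) + 1 ≠ i) :
    q o i j = 0 := by
  rcases lt_trichotomy (i : ℕ) j with hlt | heq | hlt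
  · exact h.krein_one_eq_zero_of_lt hdeg hq ho (by omega)
  · refine h.krein_eq_zero_of_odd hq hpar o i j ⟨j, ?_⟩
    omega
  · have h1 := h.multiplicity_mul_krein hq o i j
    rw [h.krein_one_eq_zero_of_lt hdeg hq ho (i := j) (j := i) (by omega), mul_zero] at h1
    exact (mul_eq_zero.mp h1).resolve_left (h.eval_diagonal_ne_zero j)

/-- The entries `b_j^*` and `c_j^*` of the dual intersection matrix. -/
theorem exists_dual_intersection_numbers (hq : IsKreinNumbers E q)
    (hpar : ∀ x y, ∃ x' y', ∀ i : Fin (d + 1),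
      (v i).eval (c x' y') = (-1) ^ (i : ℕ) * (v i).eval (c x y))
    {o : Fin (d + 1)} (ho : (o : ℕ) = 1) :
    ∃ b e : ℕ → ℝ,
      (∀ i j : Fin (d + 1), (i : ℕ) = j + 1 → q o i j = b j) ∧
      (∀ i j : Fin (d + 1), (i : ℕ) + 1 = j → q o i j = e j) ∧
      b 0 = (v 1).eval (α 0) ∧ e d = (v 1).eval (α 0) ∧
      (∀ j, 1 ≤ j → j < d → e j + b j = (v 1).eval (α 0)) ∧
      ∀ j < d, (v j).eval (α 0) * b j = (v (j + 1)).eval (α 0) * e (j + 1) := by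
  have hd : 1 ≤ d := by have := o.2; omega
  have hval : ∀ j, j ≤ d → ((Fin.ofNat (d + 1) j : Fin (d + 1)) : ℕ) = j := fun j hj => by
    simp only [Fin.val_ofNat]
    exact Nat.mod_eq_of_lt (by omega)
  have hof : ∀ (i : Fin (d + 1)) (j : ℕ), (i : ℕ) = j → i = Fin.ofNat (d + 1) j :=
    fun i j hij => by
      ext
      rw [hval j (by omega), hij]
  -- `Fin.ofNat` reduces modulo d + 1 and subtraction truncates, so `b d` and `e 0` carry no
  -- meaning; none of the identities below involves them.
  let b : ℕ → ℝ := fun j => q o (Fin.ofNat (d + 1) (j + 1)) (Fin.ofNat (d + 1) j)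
  let e : ℕ → ℝ := fun j => q o (Fin.ofNat (d + 1) (j - 1)) (Fin.ofNat (d + 1) j)
  have hsum : ∀ k : Fin (d + 1), ∑ i, q o i k = (v 1).eval (α 0) := fun k => by
    rw [h.sum_krein hq, ho]
  refine ⟨b, e, fun i j hij => ?_, fun i j hij => ?_, ?_, ?_, fun j hj1 hjd => ?_, fun j hj => ?_⟩
  · rw [hof i _ hij, hof j j rfl]
    simp [b]
  · rw [hof i (j - 1) (by omega), hof j j rfl]
    simp [e]
  · rw [← hsum (Fin.ofNat (d + 1) 0), Finset.sum_eq_single (Fin.ofNat (d + 1) (0 + 1))]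
    · intro i _ hi
      refine h.krein_one_eq_zero hdeg hq hpar ho (by rw [hval 0 (by omega)]; omega) ?_
      rw [hval 0 (by omega)]
      exact fun h1 => hi (hof i _ h1.symm)
    · simp
  · rw [← hsum (Fin.ofNat (d + 1) d), Finset.sum_eq_single (Fin.ofNat (d + 1) (d - 1))]
    · intro i _ hi
      refine h.krein_one_eq_zero hdeg hq hpar ho ?_ (by rw [hval d le_rfl]; omega)
      rw [hval d le_rfl]
      exact fun h1 => hi (hof i _ (by omega))
    · simp
  · rw [← hsum (Fin.ofNat (d + 1) j), Finset.sum_eq_add (Fin.ofNat (d + 1) (j - 1))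
      (Fin.ofNat (d + 1) (j + 1))]
    · intro h1
      have := congrArg Fin.val h1
      rw [hval _ (by omega), hval _ (by omega)] at this
      omega
    · intro i _ hi
      refine h.krein_one_eq_zero hdeg hq hpar ho ?_ ?_
      · rw [hval j (by omega)]
        exact fun h1 => hi.1 (hof i _ (by omega))
      · rw [hval j (by omega)]
        exact fun h1 => hi.2 (hof i _ h1.symm)
    · simp
    · simp
  · have h1 := h.multiplicity_mul_krein hq o (Fin.ofNat (d + 1) (j + 1)) (Fin.ofNat (d + 1) j)
    rw [hval _ (by omega), hval _ (by omega)] at h1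
    simpa [b, e] using h1

end IsSpectralFamily

end KreinNumbers

/-! ### Ordering the inner products in antipodal pairs -/

section Enumeration

/-- A finite symmetric set of reals containing `1` can be listed as `1, -1, a, -a, …`, with `0` at
the end if it occurs. -/
theorem exists_antipodal_enumeration {s : ℕ} (T : Finset ℝ) (hT : ∀ a ∈ T, -a ∈ T)
    (h1 : (1 : ℝ) ∈ T) (hc : T.card = s + 1) :
    ∃ α : Fin (s + 1) → ℝ, Function.Injective α ∧ Set.range α = T ∧ α 0 = 1 ∧
      (∀ (i : ℕ) (k l : Fin (s + 1)), (k : ℕ) = 2 * i → (l : ℕ) = 2 * i + 1 → α l = -α k) ∧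
      (Even s → α (Fin.last s) = 0) := by
  classical
  let Pos := T.filter (0 < ·)
  have hPos : ∀ a, a ∈ Pos ↔ a ∈ T ∧ 0 < a := fun a => Finset.mem_filter
  have hneg : (T.filter fun a => ¬ 0 < a).card = Pos.card + if (0 : ℝ) ∈ T then 1 else 0 := by
    have h2 : (T.filter fun a => ¬ 0 < a) = Pos.image (-·) ∪ (if (0 : ℝ) ∈ T then {0} else ∅) := by
      ext a
      simp only [Finset.mem_filter, Finset.mem_union, Finset.mem_image, hPos]
      constructor
      · rintro ⟨ha, ha'⟩
        rcases (not_lt.mp ha').lt_or_eq with h | rfl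
        · exact Or.inl ⟨-a, ⟨hT a ha, by linarith⟩, neg_neg a⟩
        · right
          simp [ha]
      · rintro (⟨b, ⟨hb, hb'⟩, rfl⟩ | h)
        · exact ⟨hT b hb, by linarith⟩
        · split_ifs at h with h0
          · rw [Finset.mem_singleton] at h
            rw [h]
            exact ⟨h0, lt_irrefl _⟩
          · simp at h
    rw [h2, Finset.card_union_of_disjoint, Finset.card_image_of_injective _ neg_injective]
    · split_ifs <;> simp
    · rw [Finset.disjoint_left]
      intro a ha ha'
      obtain ⟨b, hb, rfl⟩ := Finset.mem_image.mp ha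
      have hb' := ((hPos b).mp hb).2
      split_ifs at ha'
      · rw [Finset.mem_singleton] at ha'
        linarith
      · simp at ha'
  have hcard : s + 1 = 2 * Pos.card + if (0 : ℝ) ∈ T then 1 else 0 := by
    have := Finset.card_filter_add_card_filter_not (s := T) (fun a : ℝ => 0 < a)
    rw [hneg, hc] at this
    change Pos.card + _ = _ at this
    omega
  set p := Pos.card with hp
  have h1P : (1 : ℝ) ∈ Pos := (hPos 1).mpr ⟨h1, one_pos⟩
  have hp0 : 0 < p := Finset.card_pos.mpr ⟨1, h1P⟩
  let e : Fin p ≃ Pos := Pos.equivFin.symm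
  -- The transposition puts the element 1 in first place.
  let e' : Fin p ≃ Pos := (Equiv.swap (e.symm ⟨1, h1P⟩) ⟨0, hp0⟩).trans e
  have he0 : e' ⟨0, hp0⟩ = ⟨1, h1P⟩ := by simp [e']
  have hpos : ∀ j, 0 < ((e' j : Pos) : ℝ) := fun j => ((hPos _).mp (e' j).2).2
  have hmem : ∀ j, ((e' j : Pos) : ℝ) ∈ T := fun j => ((hPos _).mp (e' j).2).1
  -- Places 2i and 2i + 1 receive the i-th positive element and its negative. Since s + 1 is 2p or
  -- 2p + 1, the default 0 is used at most at the last place, exactly when 0 belongs to T.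
  let α : Fin (s + 1) → ℝ := fun j =>
    if h : (j : ℕ) / 2 < p then (-1) ^ (j : ℕ) * (e' ⟨(j : ℕ) / 2, h⟩ : Pos) else 0
  have hlt : ∀ (j : Fin (s + 1)) (h : (j : ℕ) / 2 < p),
      α j = (-1) ^ (j : ℕ) * (e' ⟨(j : ℕ) / 2, h⟩ : Pos) := fun j h => dif_pos h
  have hge : ∀ j : Fin (s + 1), ¬ (j : ℕ) / 2 < p → α j = 0 := fun j h => dif_neg h
  have hz : (if (0 : ℝ) ∈ T then 1 else 0) ≤ 1 := by split_ifs <;> simp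
  have hne : ∀ (j : Fin (s + 1)), (j : ℕ) / 2 < p → α j ≠ 0 := fun j h => by
    rw [hlt j h]
    exact mul_ne_zero (pow_ne_zero _ (by norm_num)) (hpos _).ne'
  have hinj : Function.Injective α := by
    intro j k hjk
    by_cases hj : (j : ℕ) / 2 < p <;> by_cases hk : (k : ℕ) / 2 < p
    · rw [hlt j hj, hlt k hk] at hjk
      have h2 := hpos ⟨(j : ℕ) / 2, hj⟩
      have h3 := hpos ⟨(k : ℕ) / 2, hk⟩
      have key : ∀ (hjk' : ((e' ⟨(j : ℕ) / 2, hj⟩ : Pos) : ℝ) = (e' ⟨(k : ℕ) / 2, hk⟩ : Pos)),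
          (j : ℕ) / 2 = (k : ℕ) / 2 := fun hjk' => by
        simpa using e'.injective (Subtype.ext hjk')
      rcases Nat.even_or_odd j with hje | hje <;> rcases Nat.even_or_odd k with hke | hke <;>
        rw [hje.neg_one_pow, hke.neg_one_pow] at hjk
      · have h4 := key (by linarith)
        obtain ⟨a, ha⟩ := hje
        obtain ⟨b, hb⟩ := hke
        ext
        omega
      · linarith
      · linarith
      · have h4 := key (by linarith)
        obtain ⟨a, ha⟩ := hje
        obtain ⟨b, hb⟩ := hke
        ext
        omega
    · exact absurd (hjk.trans (hge k hk)) (hne j hj)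
    · exact absurd (hjk.symm.trans (hge j hj)) (hne k hk)
    · ext
      have := j.2
      have := k.2
      omega
  have hαT : ∀ j, α j ∈ T := by
    intro j
    by_cases hj : (j : ℕ) / 2 < p
    · rw [hlt j hj]
      rcases Nat.even_or_odd j with h | h <;> rw [h.neg_one_pow]
      · rw [one_mul]
        exact hmem _
      · rw [neg_one_mul]
        exact hT _ (hmem _)
    · rw [hge j hj]
      by_contra h0
      rw [if_neg h0] at hcard
      have := j.2
      omega
  refine ⟨α, hinj, ?_, ?_, ?_, ?_⟩
  · have h2 : Finset.univ.image α = T := by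
      refine Finset.eq_of_subset_of_card_le ?_ ?_
      · intro a ha
        obtain ⟨j, -, rfl⟩ := Finset.mem_image.mp ha
        exact hαT j
      · rw [Finset.card_image_of_injective _ hinj, hc]
        simp
    rw [← h2]
    simp
  · rw [hlt 0 (by simpa using hp0)]
    simp [he0]
  · intro i k l hk hl
    have hi : (l : ℕ) / 2 = (k : ℕ) / 2 := by omega
    have hkp : (k : ℕ) / 2 < p := by
      have := l.2
      omega
    rw [hlt k hkp, hlt l (hi ▸ hkp)]
    simp only [hi]
    have hpow : (-1 : ℝ) ^ (l : ℕ) = -(-1) ^ (k : ℕ) := by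
      rw [hl, ← hk, pow_succ]
      ring
    rw [hpow]
    ring
  · intro hs
    refine hge _ ?_
    obtain ⟨a, ha⟩ := hs
    rw [Fin.val_last]
    omega

end Enumeration

/-! ### Closed forms of the dual intersection numbers -/

section DualIntersectionNumbers

/-- The multiplicity m_j cleared of denominators; in this form consecutive multiplicities in the
recursion share a factorial that cancels. -/
theorem choose_sub_choose_mul_factorial {n j : ℕ} (hn : 2 ≤ n) (hj : 2 ≤ j) :
    (((n + j - 1).choose j : ℝ) - (n + (j - 2) - 1).choose (j - 2)) * (j ! * (n - 2)!) =
      ((n : ℝ) + 2 * j - 2) * (n + j - 3)! := by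
  obtain ⟨a, rfl⟩ := Nat.exists_eq_add_of_le' hn
  obtain ⟨i, rfl⟩ := Nat.exists_eq_add_of_le' hj
  have e1 : a + 2 + (i + 2) - 1 = a + i + 3 := by omega
  have e2 : a + 2 + (i + 2 - 2) - 1 = a + i + 1 := by omega
  have e3 : a + 2 + (i + 2) - 3 = a + i + 1 := by omega
  rw [e1, e2, e3, Nat.add_sub_cancel, Nat.add_sub_cancel]
  have h1 : ((a + i + 3).choose (i + 2) : ℝ) * (i + 2)! * (a + 1)! = (a + i + 3)! := by
    have := Nat.choose_mul_factorial_mul_factorial (n := a + i + 3) (k := i + 2) (by omega)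
    rw [show a + i + 3 - (i + 2) = a + 1 by omega] at this
    exact_mod_cast this
  have h2 : ((a + i + 1).choose i : ℝ) * i ! * (a + 1)! = (a + i + 1)! := by
    have := Nat.choose_mul_factorial_mul_factorial (n := a + i + 1) (k := i) (by omega)
    rw [show a + i + 1 - i = a + 1 by omega] at this
    exact_mod_cast this
  have f1 : ((a + i + 3)! : ℝ) = (a + i + 3) * ((a + i + 2) * (a + i + 1)!) := by
    rw [Nat.factorial_succ (a + i + 2), Nat.factorial_succ (a + i + 1)]
    push_cast
    ring
  have f2 : ((i + 2)! : ℝ) = (i + 2) * ((i + 1) * i !) := by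
    rw [Nat.factorial_succ (i + 1), Nat.factorial_succ i]
    push_cast
    ring
  have f3 : ((a + 1)! : ℝ) = (a + 1) * a ! := by
    rw [Nat.factorial_succ]
    push_cast
    ring
  have ha : ((a : ℝ) + 1) ≠ 0 := by positivity
  refine mul_left_cancel₀ ha ?_
  push_cast
  have h3 : ((a + i + 1).choose i : ℝ) * ((i + 2)! * (a + 1)!) =
      (i + 2) * (i + 1) * (a + i + 1)! := by
    rw [f2, ← h2]
    ring
  rw [f1, f3] at h1
  rw [f3] at h3
  linear_combination h1 - h3

/-- The recursion for the dual intersection numbers is solved by the values for the sphere. -/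
theorem dual_intersection_numbers_eq {n s : ℕ} (hn : 2 ≤ n) {m b e : ℕ → ℝ} (hm0 : m 0 = 1)
    (hm : ∀ j, 1 ≤ j → j + 2 ≤ s →
      m j * (j ! * (n - 2)!) = ((n : ℝ) + 2 * j - 2) * (n + j - 3)!)
    (hb0 : b 0 = n) (hsum : ∀ j, 1 ≤ j → j < s → e j + b j = n)
    (hrec : ∀ j < s, m j * b j = m (j + 1) * e (j + 1)) (j : ℕ) (hj : 1 ≤ j) (hjs : j + 2 ≤ s) :
    e j = n * j / (n + 2 * j - 2) ∧ b j = n * (n + j - 2) / (n + 2 * j - 2) := by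
  obtain ⟨a, rfl⟩ := Nat.exists_eq_add_of_le' hn
  induction j, hj using Nat.le_induction with
  | base =>
    have h1 := hm 1 le_rfl hjs
    have h2 := hrec 0 (by omega)
    have h3 := hsum 1 le_rfl (by omega)
    have ha : ((a ! : ℕ) : ℝ) ≠ 0 := by exact_mod_cast (Nat.factorial_pos a).ne'
    have ha2 : (a : ℝ) + 2 ≠ 0 := by positivity
    rw [show a + 2 + 1 - 3 = a by omega, Nat.add_sub_cancel] at h1
    simp only [Nat.factorial_one, Nat.cast_one, one_mul] at h1
    have h4 := mul_right_cancel₀ ha h1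
    push_cast at h3 h4 hb0 ⊢
    rw [hm0, hb0, one_mul, zero_add, h4] at h2
    have h5 : e 1 = 1 := by
      refine mul_left_cancel₀ ha2 ?_
      linear_combination -h2
    have h6 : b 1 = a + 1 := by linarith
    rw [h5, h6]
    have h7 : (a : ℝ) + 2 + 2 * 1 - 2 ≠ 0 := by ring_nf; rw [add_comm]; exact ha2
    constructor
    · rw [eq_div_iff h7]; ring
    · rw [eq_div_iff h7]; ring
  | succ j hj ih =>
    obtain ⟨-, ih⟩ := ih (by omega)
    have h1 := hm j hj (by omega)
    have h2 := hm (j + 1) (by omega) hjs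
    have h3 := hrec j (by omega)
    have h4 := hsum (j + 1) (by omega) (by omega)
    obtain ⟨i, rfl⟩ := Nat.exists_eq_add_of_le' hj
    rw [show a + 2 + (i + 1) - 3 = a + i by omega, Nat.add_sub_cancel] at h1
    rw [show a + 2 + (i + 1 + 1) - 3 = a + i + 1 by omega, Nat.add_sub_cancel,
      Nat.factorial_succ (i + 1), Nat.factorial_succ (a + i)] at h2
    push_cast at h1 h2 h4 ih ⊢
    have hF : (((a + i)! : ℕ) : ℝ) ≠ 0 := by exact_mod_cast (Nat.factorial_pos _).ne'
    have hG : ((((i + 1)! : ℕ) : ℝ) * ((a ! : ℕ) : ℝ)) ≠ 0 := by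
      exact_mod_cast (mul_pos (Nat.factorial_pos _) (Nat.factorial_pos _)).ne'
    have hd1 : (a : ℝ) + 2 + 2 * (i + 1) - 2 ≠ 0 := by
      have : (0 : ℝ) < a + 2 + 2 * (i + 1) - 2 := by
        have : (0 : ℝ) ≤ a := by positivity
        have : (0 : ℝ) ≤ i := by positivity
        linarith
      exact this.ne'
    have hd2 : (a : ℝ) + 2 + 2 * (i + 1 + 1) - 2 ≠ 0 := by
      have : (0 : ℝ) < a + 2 + 2 * (i + 1 + 1) - 2 := by
        have : (0 : ℝ) ≤ a := by positivity
        have : (0 : ℝ) ≤ i := by positivity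
        linarith
      exact this.ne'
    have hd3 : (a : ℝ) + i + 1 ≠ 0 := by positivity
    rw [eq_div_iff hd1] at ih
    -- Both sides of m_j b_j = m_{j+1} c_{j+1} are expressed through (n + j - 3)!, which is then
    -- cancelled.
    have h5 : e (i + 1 + 1) * (a + 2 + 2 * (i + 1 + 1) - 2) = (a + 2) * (i + 1 + 1) := by
      refine mul_right_cancel₀ (mul_ne_zero hd3 hF) ?_
      have e1 : m (i + 1 + 1) * e (i + 1 + 1) * ((i + 1 + 1) * ((i + 1)! * a !)) =
          e (i + 1 + 1) * ((a + 2 + 2 * (i + 1 + 1) - 2) * ((a + i + 1) * (a + i)!)) := by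
        linear_combination e (i + 1 + 1) * h2
      have e2 : m (i + 1) * b (i + 1) * ((i + 1)! * a !) =
          (a + 2) * (a + 2 + (i + 1) - 2) * (a + i)! := by
        linear_combination b (i + 1) * h1 + ((a + i)! : ℝ) * ih
      rw [← h3] at e1
      linear_combination (i + 1 + 1 : ℝ) * e2 - e1
    have h6 : b (i + 1 + 1) = a + 2 - e (i + 1 + 1) := by linarith
    constructor
    · rw [eq_div_iff hd2, h5]
    · rw [eq_div_iff hd2, h6]
      linear_combination -h5

/-- The last pair of dual intersection numbers, in terms of the last but one multiplicity. -/
theorem last_dual_intersection_numbers_eq {n s N : ℕ} (hn : 2 ≤ n) (hs : 2 ≤ s) {m b e : ℕ → ℝ}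
    (hm0 : m 0 = 1)
    (hm : ∀ j, 1 ≤ j → j + 2 ≤ s →
      m j * (j ! * (n - 2)!) = ((n : ℝ) + 2 * j - 2) * (n + j - 3)!)
    (hb0 : b 0 = n) (hsum : ∀ j, 1 ≤ j → j < s → e j + b j = n)
    (hrec : ∀ j < s, m j * b j = m (j + 1) * e (j + 1)) (hlast : m (s - 1) ≠ 0)
    (hN2 : s = 2 → N = 2 * n) (hm1 : s = 2 → m 1 = n)
    (hN : 3 ≤ s → m (s - 1) = N / 2 - (n + s - 4).choose (s - 3)) :
    e (s - 1) = 2 * (n : ℝ) * (n - 1) * (n + s - 4)! /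
        ((s - 2)! * (n - 1)! * N - 2 * ((s : ℝ) - 2) * (n + s - 4)!) ∧
      b (s - 1) = ((s - 2)! * n ! * N - 2 * (n : ℝ) * (n + s - 3)!) /
        ((s - 2)! * (n - 1)! * N - 2 * ((s : ℝ) - 2) * (n + s - 4)!) := by
  have hall := dual_intersection_numbers_eq hn hm0 hm hb0 hsum hrec
  obtain ⟨a, rfl⟩ := Nat.exists_eq_add_of_le' hn
  have hfac : ∀ k : ℕ, (((k + 1)! : ℕ) : ℝ) = (k + 1) * (k ! : ℕ) := fun k => by
    rw [Nat.factorial_succ]; push_cast; ring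
  -- The common denominator is a positive multiple of m_{s-1}, hence nonzero. For s = 2 the identity
  -- rests on N = 2n and m_1 = n.
  have hden : ((s - 2)! * (a + 2 - 1)! * N - 2 * ((s : ℝ) - 2) * (a + 2 + s - 4)! : ℝ) =
      2 * (s - 2)! * (a + 1)! * m (s - 1) := by
    rw [show a + 2 - 1 = a + 1 by omega]
    rcases hs.lt_or_eq with h3 | rfl
    · obtain ⟨i, rfl⟩ := Nat.exists_eq_add_of_le' (show 3 ≤ s from h3)
      rw [hN (by omega), show a + 2 + (i + 3) - 4 = a + i + 1 by omega,
        show i + 3 - 3 = i by omega, show i + 3 - 2 = i + 1 by omega]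
      have h2 : ((a + i + 1).choose i : ℝ) * i ! * (a + 1)! = (a + i + 1)! := by
        have := Nat.choose_mul_factorial_mul_factorial (n := a + i + 1) (k := i) (by omega)
        rw [show a + i + 1 - i = a + 1 by omega] at this
        exact_mod_cast this
      rw [hfac i]
      push_cast
      linear_combination (2 * (i + 1 : ℝ)) * h2
    · rw [hN2 rfl]
      simp only [Nat.sub_self, Nat.factorial_zero, show 2 - 1 = 1 by rfl, hm1 rfl]
      push_cast
      ring
  have hden0 : ((s - 2)! * (a + 2 - 1)! * N - 2 * ((s : ℝ) - 2) * (a + 2 + s - 4)! : ℝ) ≠ 0 := by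
    rw [hden]
    refine mul_ne_zero (mul_ne_zero (mul_ne_zero two_ne_zero ?_) ?_) hlast <;>
      exact_mod_cast (Nat.factorial_pos _).ne'
  have he : e (s - 1) * ((s - 2)! * (a + 2 - 1)! * N - 2 * ((s : ℝ) - 2) * (a + 2 + s - 4)! : ℝ) =
      2 * ((a + 2 : ℕ) : ℝ) * ((a + 2 : ℕ) - 1) * (a + 2 + s - 4)! := by
    rw [hden]
    rcases hs.lt_or_eq with h3 | rfl
    · obtain ⟨i, rfl⟩ := Nat.exists_eq_add_of_le' (show 3 ≤ s from h3)
      have h1 := hrec (i + 1) (by omega)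
      have h2 := hm (i + 1) (by omega) (by omega)
      have h4 := (hall (i + 1) (by omega) (by omega)).2
      rw [show a + 2 + (i + 1) - 3 = a + i by omega, Nat.add_sub_cancel] at h2
      rw [show i + 3 - 1 = i + 1 + 1 by omega, show i + 3 - 2 = i + 1 by omega,
        show a + 2 + (i + 3) - 4 = a + i + 1 by omega, hfac (a + i), hfac a]
      push_cast at h2 h4 ⊢
      have hd1 : (a : ℝ) + 2 + 2 * (i + 1) - 2 ≠ 0 := by
        have : (0 : ℝ) < a + 2 + 2 * (i + 1) - 2 := by
          have : (0 : ℝ) ≤ a := by positivity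
          have : (0 : ℝ) ≤ i := by positivity
          linarith
        exact this.ne'
      rw [eq_div_iff hd1] at h4
      have e2 : m (i + 1) * b (i + 1) * ((i + 1)! * a !) =
          (a + 2) * (a + 2 + (i + 1) - 2) * (a + i)! := by
        linear_combination b (i + 1) * h2 + ((a + i)! : ℝ) * h4
      rw [h1] at e2
      linear_combination (2 * (a + 1 : ℝ)) * e2
    · have h1 := hrec 0 (by omega)
      rw [hm0, hb0, zero_add, one_mul] at h1
      simp only [Nat.sub_self, Nat.factorial_zero, show 2 - 1 = 1 by rfl,
        show a + 2 + 2 - 4 = a by omega]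
      rw [hfac a]
      push_cast at h1 ⊢
      linear_combination (-(2 * (a + 1 : ℝ) * a !)) * h1
  refine ⟨by rw [eq_div_iff hden0, he], ?_⟩
  have hb : b (s - 1) = ((a + 2 : ℕ) : ℝ) - e (s - 1) := by
    have := hsum (s - 1) (by omega) (by omega)
    linarith
  rw [eq_div_iff hden0, hb, sub_mul, he]
  obtain ⟨i, rfl⟩ := Nat.exists_eq_add_of_le' hs
  rw [show a + 2 + (i + 2) - 4 = a + i by omega, show a + 2 + (i + 2) - 3 = a + i + 1 by omega,
    show a + 2 - 1 = a + 1 by omega, hfac (a + 1), hfac (a + i)]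
  push_cast
  ring

end DualIntersectionNumbers

/-! ### Differences of kernels as orthogonal idempotents -/

section KernelDifferences

open Polynomial

variable {n s : ℕ} {X : Finset (EuclideanSpace ℝ (Fin n))} {f : ℕ → ℝ[X]}

/-- A sequence of polynomials, shifted by two places. -/
noncomputable def shiftTwo (f : ℕ → ℝ[X]) (k : ℕ) : ℝ[X] := if k < 2 then 0 else f (k - 2)

/-- The differences `f_k - f_{k-2}`. -/
noncomputable def diffTwo (f : ℕ → ℝ[X]) (k : ℕ) : ℝ[X] := f k - shiftTwo f k

theorem shiftTwo_add_two (f : ℕ → ℝ[X]) (k : ℕ) : shiftTwo f (k + 2) = f k := by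
  simp [shiftTwo]

namespace IsKernelSequence

variable (hf : IsKernelSequence X s f)

include hf

theorem natDegree_diffTwo_le (k : ℕ) (hk : k ≤ s) : (diffTwo f k).natDegree ≤ k := by
  refine (natDegree_sub_le _ _).trans (max_le (hf.natDegree_le k hk) ?_)
  rw [shiftTwo]
  split_ifs
  · simp
  · exact (hf.natDegree_le _ (by omega)).trans (by omega)

theorem eval_neg_shiftTwo (k : ℕ) (hk : k ≤ s + 2) {x y : EuclideanSpace ℝ (Fin n)} (hx : x ∈ X)
    (hy : y ∈ X) :
    (shiftTwo f k).eval (-inner ℝ x y) = (-1) ^ k * (shiftTwo f k).eval (inner ℝ x y) := by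
  rcases lt_or_ge k 2 with h | h
  · simp [shiftTwo, h]
  · obtain ⟨k, rfl⟩ := Nat.exists_eq_add_of_le' h
    rw [shiftTwo_add_two, hf.eval_neg k (by omega) x hx y hy, pow_add]
    norm_num

theorem eval_neg_diffTwo (k : ℕ) (hk : k ≤ s) {x y : EuclideanSpace ℝ (Fin n)} (hx : x ∈ X)
    (hy : y ∈ X) :
    (diffTwo f k).eval (-inner ℝ x y) = (-1) ^ k * (diffTwo f k).eval (inner ℝ x y) := by
  rw [diffTwo, eval_sub, eval_sub, hf.eval_neg k hk x hx y hy,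
    hf.eval_neg_shiftTwo k (by omega) hx hy, mul_sub]

theorem sum_shiftTwo_mul_of_le (hanti : ∀ x ∈ X, -x ∈ X) (k l : ℕ) (hkl : k ≤ l) (hl : l ≤ s + 2)
    {x y : EuclideanSpace ℝ (Fin n)} (hx : x ∈ X) (hy : y ∈ X) :
    ∑ z ∈ X, (shiftTwo f k).eval (inner ℝ x z) * (shiftTwo f l).eval (inner ℝ z y) =
      if Even (k + l) then X.card * (shiftTwo f k).eval (inner ℝ x y) else 0 := by
  split_ifs with hev
  · rcases lt_or_ge k 2 with h | h
    · simp [shiftTwo, h]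
    · obtain ⟨k, rfl⟩ := Nat.exists_eq_add_of_le' h
      obtain ⟨a, ha⟩ := hev
      obtain ⟨j, rfl⟩ : ∃ j, l = k + 2 * j + 2 := ⟨a - k - 2, by omega⟩
      rw [shiftTwo_add_two, shiftTwo_add_two]
      exact hf.sum_mul k j (by omega) x hx y hy
  · exact sum_mul_eq_zero_of_parity hanti
      (fun x hx y hy => hf.eval_neg_shiftTwo k (by omega) hx hy)
      (fun x hx y hy => hf.eval_neg_shiftTwo l hl hx hy) (Nat.not_even_iff_odd.mp hev) hx hy

theorem sum_shiftTwo_mul (hanti : ∀ x ∈ X, -x ∈ X) (k l : ℕ) (hk : k ≤ s + 2) (hl : l ≤ s + 2)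
    {x y : EuclideanSpace ℝ (Fin n)} (hx : x ∈ X) (hy : y ∈ X) :
    ∑ z ∈ X, (shiftTwo f k).eval (inner ℝ x z) * (shiftTwo f l).eval (inner ℝ z y) =
      if Even (k + l) then X.card * (shiftTwo f (min k l)).eval (inner ℝ x y) else 0 := by
  rcases le_total k l with h | h
  · rw [min_eq_left h]
    exact hf.sum_shiftTwo_mul_of_le hanti k l h hl hx hy
  · rw [min_eq_right h, add_comm k l, real_inner_comm y x,
      ← hf.sum_shiftTwo_mul_of_le hanti l k h hk hy hx]
    refine Finset.sum_congr rfl fun z _ => ?_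
    rw [real_inner_comm z x, real_inner_comm y z, mul_comm]

/-- Differences of consecutive terms in a nested chain of projections are mutually orthogonal. Both
terms are written as members of the one sequence `shiftTwo f`, which starts with zeros, so that the
indices 0 and 1 need no separate treatment. -/
theorem sum_diffTwo_mul (hanti : ∀ x ∈ X, -x ∈ X) (k l : ℕ) (hk : k ≤ s) (hl : l ≤ s)
    {x y : EuclideanSpace ℝ (Fin n)} (hx : x ∈ X) (hy : y ∈ X) :
    ∑ z ∈ X, (diffTwo f k).eval (inner ℝ x z) * (diffTwo f l).eval (inner ℝ z y) =
      if k = l then X.card * (diffTwo f k).eval (inner ℝ x y) else 0 := by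
  have hd : ∀ k, diffTwo f k = shiftTwo f (k + 2) - shiftTwo f k := fun k => by
    rw [shiftTwo_add_two, diffTwo]
  have hexp : ∀ z, (diffTwo f k).eval (inner ℝ x z) * (diffTwo f l).eval (inner ℝ z y) =
      (shiftTwo f (k + 2)).eval (inner ℝ x z) * (shiftTwo f (l + 2)).eval (inner ℝ z y) -
      (shiftTwo f k).eval (inner ℝ x z) * (shiftTwo f (l + 2)).eval (inner ℝ z y) -
      ((shiftTwo f (k + 2)).eval (inner ℝ x z) * (shiftTwo f l).eval (inner ℝ z y) -
      (shiftTwo f k).eval (inner ℝ x z) * (shiftTwo f l).eval (inner ℝ z y)) := by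
    intro z
    rw [hd, hd, eval_sub, eval_sub]
    ring
  simp only [hexp, Finset.sum_sub_distrib]
  rw [hf.sum_shiftTwo_mul hanti (k + 2) (l + 2) (by omega) (by omega) hx hy,
    hf.sum_shiftTwo_mul hanti k (l + 2) (by omega) (by omega) hx hy,
    hf.sum_shiftTwo_mul hanti (k + 2) l (by omega) (by omega) hx hy,
    hf.sum_shiftTwo_mul hanti k l (by omega) (by omega) hx hy]
  by_cases hev : Even (k + l)
  · have h1 : Even (k + 2 + (l + 2)) := by rw [Nat.even_iff] at hev ⊢; omega
    have h2 : Even (k + (l + 2)) := by rw [Nat.even_iff] at hev ⊢; omega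
    have h3 : Even (k + 2 + l) := by rw [Nat.even_iff] at hev ⊢; omega
    rw [if_pos h1, if_pos h2, if_pos h3, if_pos hev]
    rw [Nat.even_iff] at hev
    rcases lt_trichotomy k l with h | rfl | h
    · rw [if_neg h.ne, min_eq_left (by omega : k + 2 ≤ l + 2), min_eq_left (by omega : k ≤ l + 2),
        min_eq_left (by omega : k + 2 ≤ l), min_eq_left h.le]
      ring
    · rw [if_pos rfl, min_self, min_self, min_eq_left (by omega : k ≤ k + 2),
        min_eq_right (by omega : k ≤ k + 2), hd, eval_sub]
      ring
    · rw [if_neg h.ne', min_eq_right (by omega : l + 2 ≤ k + 2), min_eq_right (by omega : l + 2 ≤ k),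
        min_eq_right (by omega : l ≤ k + 2), min_eq_right h.le]
      ring
  · have h1 : ¬ Even (k + 2 + (l + 2)) := by rw [Nat.even_iff] at hev ⊢; omega
    have h2 : ¬ Even (k + (l + 2)) := by rw [Nat.even_iff] at hev ⊢; omega
    have h3 : ¬ Even (k + 2 + l) := by rw [Nat.even_iff] at hev ⊢; omega
    have h4 : k ≠ l := by rintro rfl; exact hev ⟨k, rfl⟩
    rw [if_neg h1, if_neg h2, if_neg h3, if_neg hev, if_neg h4]
    ring

theorem eval_one_diffTwo (k : ℕ) (hk : k + 2 ≤ s) :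
    (diffTwo f k).eval 1 = (n + k - 1).choose k -
      if k < 2 then 0 else ((n + (k - 2) - 1).choose (k - 2) : ℝ) := by
  rw [diffTwo, eval_sub, hf.eval_one k hk, shiftTwo]
  split_ifs
  · simp
  · rw [hf.eval_one (k - 2) (by omega)]

theorem eval_one_last (hX : X.Nonempty) (hu : ∀ x ∈ X, ‖x‖ = 1) (k : ℕ) (hk : k ≤ s)
    (hk' : s ≤ k + 1) :
    (f k).eval 1 = X.card / 2 := by
  obtain ⟨x, hx⟩ := hX
  have := hf.eval_inner k hk hk' x hx x hx
  rw [(inner_eq_one_iff_of_mem hu hx hx).mpr rfl, if_pos rfl,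
    if_neg (ne_neg_self_of_mem hu hx)] at this
  rw [this]
  ring

theorem eval_one_diffTwo_last (hX : X.Nonempty) (hu : ∀ x ∈ X, ‖x‖ = 1) (k : ℕ) (hk : k ≤ s)
    (hk' : s ≤ k + 1) :
    (diffTwo f k).eval 1 = X.card / 2 -
      if k < 2 then 0 else ((n + (k - 2) - 1).choose (k - 2) : ℝ) := by
  rw [diffTwo, eval_sub, hf.eval_one_last hX hu k hk hk', shiftTwo]
  split_ifs
  · simp
  · rw [hf.eval_one (k - 2) (by omega)]

theorem diffTwo_zero : diffTwo f 0 = 1 := by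
  simp [diffTwo, shiftTwo, hf.zero]

/-- For k ≥ s-1 the leading term of f_k survives because its degree is exactly k. Below that, the
value at 1 is a positive multiplicity. -/
theorem diffTwo_ne_zero (hn : 2 ≤ s → 2 ≤ n) (k : ℕ) (hk : k ≤ s) : diffTwo f k ≠ 0 := by
  rcases lt_or_ge s (k + 2) with h | h
  · intro h0
    obtain ⟨h1, h2⟩ := hf.natDegree_eq k hk (by omega)
    rw [diffTwo, sub_eq_zero, shiftTwo] at h0
    split_ifs at h0 with hk2
    · exact h2 h0
    · rw [h0] at h1
      have := hf.natDegree_le (k - 2) (by omega)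
      omega
  · intro h0
    have h1 := hf.eval_one_diffTwo k h
    rw [h0, eval_zero] at h1
    obtain ⟨a, rfl⟩ := Nat.exists_eq_add_of_le' (hn (by omega))
    split_ifs at h1 with hk2
    · rw [sub_zero] at h1
      have h2 : 0 < (a + 2 + k - 1).choose k := Nat.choose_pos (by omega)
      have : ((a + 2 + k - 1).choose k : ℝ) ≠ 0 := by exact_mod_cast h2.ne'
      exact this h1.symm
    · have h2 := choose_sub_choose_mul_factorial (n := a + 2) (j := k) (by omega) (by omega)
      rw [← h1, zero_mul] at h2
      have h3 : (0 : ℝ) < (((a + 2 : ℕ) : ℝ) + 2 * k - 2) * (a + 2 + k - 3)! := by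
        refine mul_pos ?_ (by exact_mod_cast Nat.factorial_pos _)
        have : (2 : ℝ) ≤ k := by exact_mod_cast (by omega : 2 ≤ k)
        push_cast
        have : (0 : ℝ) ≤ a := by positivity
        linarith
      linarith

end IsKernelSequence

end KernelDifferences

theorem binom_natCast (a k : ℕ) : binom (a : ℤ) (k : ℤ) = a.choose k := by
  simp [binom]

theorem binom_of_neg {a k : ℤ} (hk : k < 0) : binom a k = 0 := if_pos hk

/-! ### The association scheme of the design -/

section MainTheorem

open Polynomial

/-- Since v_1 is linear and not constant, c is recovered from v_1(c); composing v_i with the inverse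
linear polynomial keeps the degree. -/
theorem isQPolynomial_of_degree {V : Type*} [Fintype V] [Nonempty V] {d : ℕ} (hd : 1 ≤ d)
    {c : V → V → ℝ} {α : Fin (d + 1) → ℝ} {v : ℕ → ℝ[X]} {E : Fin (d + 1) → Matrix V V ℝ}
    (h : IsSpectralFamily c α (fun i r => (Fintype.card V : ℝ)⁻¹ * (v i).eval r) E)
    (hdeg : ∀ i ≤ d, (v i).natDegree ≤ i) : IsQPolynomial E := by
  have h1 := h.degree_eq hdeg 1 hd
  have hv1 := eq_X_add_C_of_degree_eq_one (p := v 1) (by exact_mod_cast h1)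
  set a := (v 1).leadingCoeff with ha
  set b := (v 1).coeff 0
  have ha0 : a ≠ 0 := by
    rw [ha, leadingCoeff_ne_zero]
    intro h0
    rw [h0, degree_zero] at h1
    exact absurd h1.symm (WithBot.natCast_ne_bot _)
  have hlin : (C a⁻¹ * (X - C b)).natDegree = 1 := by
    rw [natDegree_C_mul (inv_ne_zero ha0), natDegree_X_sub_C]
  refine ⟨fun i => (v i).comp (C a⁻¹ * (X - C b)), fun i => ?_, fun o ho i x y => ?_⟩
  · have hi := h.degree_eq hdeg i (by omega)
    have hne : v i ≠ 0 := by
      intro h0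
      rw [h0, degree_zero] at hi
      exact absurd hi.symm (WithBot.natCast_ne_bot _)
    have hne' : (v i).comp (C a⁻¹ * (X - C b)) ≠ 0 := by
      rw [Ne, comp_eq_zero_iff, not_or]
      refine ⟨hne, fun h2 => ?_⟩
      have := congrArg natDegree h2.2
      rw [hlin, natDegree_C] at this
      omega
    rw [degree_eq_natDegree hne', natDegree_comp, hlin, mul_one,
      natDegree_eq_of_degree_eq_some hi]
  · rw [← h.eval_eq, ← h.eval_eq, eval_comp, ho]
    congr 1
    have h2 : (v 1).eval (c x y) = a * c x y + b := by
      conv_lhs => rw [hv1]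
      simp
    rw [h2]
    simp only [eval_mul, eval_C, eval_sub, eval_X]
    field_simp
    ring

variable {n s : ℕ} {X : Finset (EuclideanSpace ℝ (Fin n))}

theorem IsKernelSequence.isSpectralFamily {f : ℕ → ℝ[X]} (hf : IsKernelSequence X s f)
    (hX : X.Nonempty) (hu : ∀ x ∈ X, ‖x‖ = 1) (hanti : ∀ x ∈ X, -x ∈ X) (hn : 2 ≤ s → 2 ≤ n)
    {α : Fin (s + 1) → ℝ} (hα : Function.Injective α)
    (hr : Set.range α = insert 1 (innerProducts X)) (hα0 : α 0 = 1) :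
    IsSpectralFamily
      (fun x y : X => inner ℝ (x : EuclideanSpace ℝ (Fin n)) (y : EuclideanSpace ℝ (Fin n))) α
      (fun i r => (Fintype.card X : ℝ)⁻¹ * (diffTwo f i).eval r)
      (fun i => Matrix.of fun x y => (Fintype.card X : ℝ)⁻¹ *
        (diffTwo f i).eval (inner ℝ (x : EuclideanSpace ℝ (Fin n)) y)) where
  symm x y := real_inner_comm _ _
  injective := hα
  cover x y := by
    have := inner_mem_insert_innerProducts hu x.2 y.2
    rw [← hr] at this
    obtain ⟨i, hi⟩ := this
    exact ⟨i, hi.symm⟩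
  attained i := by
    have : α i ∈ insert 1 (innerProducts X) := hr ▸ Set.mem_range_self i
    rcases this with h | ⟨x, hx, y, hy, -, h⟩
    · obtain ⟨x, hx⟩ := hX
      exact ⟨⟨x, hx⟩, ⟨x, hx⟩, ((inner_eq_one_iff_of_mem hu hx hx).mpr rfl).trans h.symm⟩
    · exact ⟨⟨x, hx⟩, ⟨y, hy⟩, h⟩
  diagonal x y := by
    rw [hα0, inner_eq_one_iff_of_mem hu x.2 y.2, Subtype.ext_iff]
  entry i x y := rfl
  mul i j := by
    have hc : (X.card : ℝ) ≠ 0 := by exact_mod_cast hX.card_pos.ne'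
    ext x y
    rw [Matrix.mul_apply]
    simp only [Matrix.of_apply, Fintype.card_coe]
    have h1 := hf.sum_diffTwo_mul hanti i j (by omega) (by omega) x.2 y.2
    rw [← Finset.sum_coe_sort X] at h1
    have h2 : ∀ z : X, (X.card : ℝ)⁻¹ * (diffTwo f i).eval
        (inner ℝ (x : EuclideanSpace ℝ (Fin n)) z) * ((X.card : ℝ)⁻¹ * (diffTwo f j).eval
        (inner ℝ (z : EuclideanSpace ℝ (Fin n)) y)) = (X.card : ℝ)⁻¹ * (X.card : ℝ)⁻¹ *
        ((diffTwo f i).eval (inner ℝ (x : EuclideanSpace ℝ (Fin n)) z) *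
        (diffTwo f j).eval (inner ℝ (z : EuclideanSpace ℝ (Fin n)) y)) := fun z => by ring
    rw [Finset.sum_congr rfl fun z _ => h2 z, ← Finset.mul_sum, h1]
    by_cases hij : i = j
    · subst hij
      simp only [if_true, Matrix.of_apply]
      field_simp
    · rw [if_neg hij, if_neg (fun h => hij (Fin.ext h))]
      simp
  ne_zero i h0 := by
    have hc : (Fintype.card X : ℝ) ≠ 0 := by
      rw [Fintype.card_coe]
      exact_mod_cast hX.card_pos.ne'
    refine hf.diffTwo_ne_zero hn i (by omega) ?_
    -- If E_i were zero, a polynomial of degree at most s would vanish at the s + 1 distinct values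
    -- of α.
    refine eq_zero_of_natDegree_lt_card_of_eval_eq_zero _ hα (fun j => ?_) ?_
    · have : α j ∈ insert 1 (innerProducts X) := hr ▸ Set.mem_range_self j
      have hxy : ∃ x ∈ X, ∃ y ∈ X, inner ℝ x y = α j := by
        rcases this with h | ⟨x, hx, y, hy, -, h⟩
        · obtain ⟨x, hx⟩ := hX
          exact ⟨x, hx, x, hx, ((inner_eq_one_iff_of_mem hu hx hx).mpr rfl).trans h.symm⟩
        · exact ⟨x, hx, y, hy, h⟩
      obtain ⟨x, hx, y, hy, h⟩ := hxy
      have h1 := congrFun (congrFun h0 ⟨x, hx⟩) ⟨y, hy⟩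
      simp only [Matrix.of_apply, Matrix.zero_apply, h] at h1
      exact (mul_eq_zero.mp h1).resolve_left (inv_ne_zero hc)
    · rw [Fintype.card_fin]
      have := hf.natDegree_diffTwo_le i (by omega)
      omega

end MainTheorem

theorem theorem1p2 (n s t : ℕ) (X : Finset (EuclideanSpace ℝ (Fin n)))
    (hX : IsSphericalDesign t X) (hanti : ∀ x ∈ X, -x ∈ X)
    (hs : (innerProducts X).ncard = s) (hst : 2 * s ≤ t + 3) :
    ∃ (S : AssociationScheme X s) (E : Fin (s + 1) → Matrix X X ℝ)
      (P Q : Fin (s + 1) → Fin (s + 1) → ℝ)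
      (q : Fin (s + 1) → Fin (s + 1) → Fin (s + 1) → ℝ),
      -- the relations are given by the inner products
      (∃ α : Fin (s + 1) → ℝ, Function.Injective α ∧
        Set.range α = insert 1 (innerProducts X) ∧
        ∀ (i : Fin (s + 1)) (x y : X), S.rel i x y ↔
          inner ℝ (x : EuclideanSpace ℝ (Fin n)) (y : EuclideanSpace ℝ (Fin n)) = α i) ∧
      S.IsIdempotentOrdering E ∧ S.IsFirstEigenmatrix E P ∧ S.IsSecondEigenmatrix E Q ∧
      IsKreinNumbers E q ∧
      -- (1)
      (∀ i j : Fin (s + 1), (j : ℕ) = 1 → P j i = (-1) ^ (i : ℕ)) ∧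
      -- (2)
      (∀ (i : ℕ) (j k l : Fin (s + 1)), (k : ℕ) = 2 * i → (l : ℕ) = 2 * i + 1 →
        Q j l = (-1) ^ (j : ℕ) * Q j k) ∧
      (Even s → ∀ j : Fin (s + 1), Odd (j : ℕ) → Q j (Fin.last s) = 0) ∧
      -- (3)
      (∀ i : Fin (s + 1), ((E i).rank : ℝ) = Q i 0) ∧
      (∀ i : Fin (s + 1), (i : ℕ) + 2 ≤ s →
        Q i 0 = binom (n + i - 1) i - binom (n + i - 3) (i - 2)) ∧
      (∀ i : Fin (s + 1), (i : ℕ) + 1 = s →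
        Q i 0 = (X.card : ℝ) / 2 - binom (n + s - 4) (s - 3)) ∧
      Q (Fin.last s) 0 = (X.card : ℝ) / 2 - binom (n + s - 3) (s - 2) ∧
      -- (4)
      (∀ i j k : Fin (s + 1), Odd ((i : ℕ) + j + k) → q i j k = 0) ∧
      -- (5)
      IsQPolynomial E ∧
      (∀ o i j : Fin (s + 1), (o : ℕ) = 1 → (i : ℕ) + 1 ≠ j → (j : ℕ) + 1 ≠ i → q o i j = 0) ∧
      (2 ≤ s → 2 ≤ t → ∀ o i j : Fin (s + 1), (o : ℕ) = 1 →
        ((i : ℕ) = 1 → (j : ℕ) = 0 → q o i j = n) ∧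
        ((i : ℕ) + 1 = s → (j : ℕ) = s → q o i j = n) ∧
        ((i : ℕ) + 1 = j → (j : ℕ) + 2 ≤ s →
          q o i j = (n : ℝ) * (j : ℕ) / (n + 2 * (j : ℕ) - 2)) ∧
        (1 ≤ (j : ℕ) → (i : ℕ) = j + 1 → (j : ℕ) + 2 ≤ s →
          q o i j = (n : ℝ) * (n + (j : ℕ) - 2) / (n + 2 * (j : ℕ) - 2)) ∧
        ((i : ℕ) + 2 = s → (j : ℕ) + 1 = s →
          q o i j = 2 * (n : ℝ) * (n - 1) * (n + s - 4)! /
            ((s - 2)! * (n - 1)! * X.card - 2 * ((s : ℝ) - 2) * (n + s - 4)!)) ∧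
        ((i : ℕ) = s → (j : ℕ) + 1 = s →
          q o i j = ((s - 2)! * n ! * X.card - 2 * (n : ℝ) * (n + s - 3)!) /
            ((s - 2)! * (n - 1)! * X.card - 2 * ((s : ℝ) - 2) * (n + s - 4)!))) := by
  classical
  have hu := hX.2.1
  have hne := hX.1
  have hcard : (X.card : ℝ) ≠ 0 := by exact_mod_cast hne.card_pos.ne'
  have hfin := finite_innerProducts X
  have hn : 2 ≤ s → 2 ≤ n := fun h => two_le_dim_of_two_le_ncard hu (hs ▸ h)
  have hs1 : 1 ≤ s := by
    rw [← hs]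
    exact (Set.ncard_pos hfin).mpr ⟨_, neg_one_mem_innerProducts hu hanti hne⟩
  obtain ⟨f, hf⟩ := hX.exists_isKernelSequence hanti hs hst
  obtain ⟨α, hα, hr, hα0, hpair, hαlast⟩ := exists_antipodal_enumeration (s := s)
    (insert 1 hfin.toFinset)
    (fun a ha => by
      have h1 := neg_mem_insert_innerProducts hu hanti hne (a := a) (by simpa using ha)
      simpa using h1)
    (Finset.mem_insert_self _ _)
    (by
      rw [Finset.card_insert_of_notMem (by simpa using one_notMem_innerProducts hu),
        ← Set.ncard_eq_toFinset_card _ hfin, hs])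
  have hr' : Set.range α = insert 1 (innerProducts X) := by rw [hr]; simp
  have h := hf.isSpectralFamily hne hu hanti hn hα hr' hα0
  have hVne : Nonempty X := hne.to_subtype
  have hdeg := hf.natDegree_diffTwo_le
  have hpar : ∀ x y : X, ∃ x' y' : X, ∀ i : Fin (s + 1),
      (diffTwo f i).eval (inner ℝ (x' : EuclideanSpace ℝ (Fin n)) y') =
        (-1) ^ (i : ℕ) * (diffTwo f i).eval (inner ℝ (x : EuclideanSpace ℝ (Fin n)) y) :=
    fun x y => ⟨x, ⟨-y, hanti y y.2⟩, fun i => by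
      rw [inner_neg_right]
      exact hf.eval_neg_diffTwo i (by omega) x.2 y.2⟩
  have hparα : ∀ (j : Fin (s + 1)) (k : Fin (s + 1)),
      (diffTwo f j).eval (-α k) = (-1) ^ (j : ℕ) * (diffTwo f j).eval (α k) := by
    intro j k
    obtain ⟨x, y, hxy⟩ := h.attained k
    rw [← hxy]
    exact hf.eval_neg_diffTwo j (by omega) x.2 y.2
  obtain ⟨P, hP⟩ := h.exists_isFirstEigenmatrix
  obtain ⟨q, hq⟩ := h.exists_isKreinNumbers
  have hQ := h.isSecondEigenmatrix
  have hc : (Fintype.card X : ℝ) ≠ 0 := by rwa [Fintype.card_coe]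
  simp only [mul_inv_cancel_left₀ hc] at hQ
  have hlast : ∀ k, k ≤ s → s ≤ k + 1 → ((diffTwo f k).eval 1 = X.card / 2 -
      if k < 2 then 0 else ((n + (k - 2) - 1).choose (k - 2) : ℝ)) :=
    hf.eval_one_diffTwo_last hne hu
  refine ⟨h.scheme, _, P, fun j i => (diffTwo f j).eval (α i), q, ⟨α, hα, hr', fun i x y => Iff.rfl⟩,
    h.isIdempotentOrdering ?_, hP, hQ, hq, ?_, ?_, ?_, ?_, ?_, ?_, ?_, ?_, ?_, ?_, ?_⟩
  · ext x y
    simp [hf.diffTwo_zero]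
  · intro i j hj
    have hαj : α j = -1 := by
      rw [hpair 0 0 j (by simp) (by simpa using hj), hα0]
    -- The entry of D_1 at (x, y) is the entry of the identity ∑ E_i at (x, -y), and parity turns
    -- the latter into ∑ (-1)^i E_i at (x, y).
    have h1 : (fun i => P j i) = fun i : Fin (s + 1) => (-1 : ℝ) ^ (i : ℕ) := by
      refine h.coeff_unique ?_
      rw [← hP j, h.scheme_adj]
      ext x y
      have h2 := h.sum_eval x ⟨-y, hanti y y.2⟩
      simp only [inner_neg_right, hα0] at h2
      have h3 : ∀ i : Fin (s + 1), (diffTwo f i).eval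
          (-inner ℝ (x : EuclideanSpace ℝ (Fin n)) y) = (-1) ^ (i : ℕ) *
          (diffTwo f i).eval (inner ℝ (x : EuclideanSpace ℝ (Fin n)) y) :=
        fun i => hf.eval_neg_diffTwo i (by omega) x.2 y.2
      simp only [h3, neg_eq_iff_eq_neg] at h2
      simp only [Matrix.sum_apply, Matrix.smul_apply, Matrix.of_apply, smul_eq_mul, hαj]
      refine mul_left_cancel₀ hc ?_
      rw [← h2, Finset.mul_sum]
      refine Finset.sum_congr rfl fun i _ => ?_
      field_simp
    exact congrFun h1 i
  · intro i j k l hk hl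
    change (diffTwo f j).eval (α l) = _ * (diffTwo f j).eval (α k)
    rw [hpair i k l hk hl, hparα]
  · intro hev j hj
    change (diffTwo f j).eval (α (Fin.last s)) = 0
    have h1 := hparα j (Fin.last s)
    rw [hαlast hev, neg_zero, hj.neg_one_pow] at h1
    rw [hαlast hev]
    linarith
  · intro i
    rw [h.rank_eq, mul_inv_cancel_left₀ hc]
  · intro i hi
    change (diffTwo f i).eval (α 0) = _
    have hn2 := hn (by omega)
    rw [hα0, hf.eval_one_diffTwo i hi]
    congr 1
    · rw [← binom_natCast]
      congr 1
      omega
    · split_ifs with h2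
      · rw [binom_of_neg (by omega)]
      · rw [← binom_natCast]
        congr 1 <;> omega
  · intro i hi
    change (diffTwo f i).eval (α 0) = _
    rw [hα0, hlast i (by omega) (by omega)]
    congr 1
    split_ifs with h2
    · rw [binom_of_neg (by omega)]
    · have hn2 := hn (by omega)
      rw [← binom_natCast]
      congr 1 <;> omega
  · change (diffTwo f (Fin.last s : Fin (s + 1))).eval (α 0) = _
    rw [hα0, Fin.val_last, hlast s le_rfl (by omega)]
    congr 1
    split_ifs with h2
    · rw [binom_of_neg (by omega)]
    · have hn2 := hn (by omega)
      rw [← binom_natCast]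
      congr 1 <;> omega
  · intro i j k hodd
    exact h.krein_eq_zero_of_odd hq hpar i j k hodd
  · exact isQPolynomial_of_degree hs1 h hdeg
  · intro o i j ho hij hji
    exact h.krein_one_eq_zero hdeg hq hpar ho hij hji
  · intro hs2 ht2 o i j ho
    have hn2 := hn hs2
    obtain ⟨b, e, hb, he, hb0, hed, hsum, hrec⟩ :=
      h.exists_dual_intersection_numbers hdeg hq hpar ho
    rw [hα0] at hb0 hed hsum hrec
    have hN2 : s = 2 → X.card = 2 * n := fun h2 =>
      hX.card_eq_two_mul hanti (hs.trans h2) ht2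
    -- For s = 2 the index 1 is already the last but one, with multiplicity |X|/2; this is where t ≥
    -- 2 enters, through |X| = 2n.
    have hm1 : (diffTwo f 1).eval 1 = n := by
      rcases hs2.lt_or_eq with h3 | h2
      · rw [hf.eval_one_diffTwo 1 h3]
        simp
      · rw [hlast 1 (by omega) (by omega), hN2 h2.symm]
        simp
    rw [hm1] at hb0 hed hsum
    have hm0 : (diffTwo f 0).eval 1 = 1 := by simp [hf.diffTwo_zero]
    have hm : ∀ j, 1 ≤ j → j + 2 ≤ s → (diffTwo f j).eval 1 * (j ! * (n - 2)!) =
        ((n : ℝ) + 2 * j - 2) * (n + j - 3)! := by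
      intro j hj hjs
      rcases hj.lt_or_eq with hj2 | rfl
      · rw [hf.eval_one_diffTwo j hjs, if_neg (by omega)]
        exact choose_sub_choose_mul_factorial hn2 hj2
      · rw [hm1, show n + 1 - 3 = n - 2 by omega]
        simp
    have hsphere := dual_intersection_numbers_eq (m := fun j => (diffTwo f j).eval 1)
      hn2 hm0 hm hb0 hsum hrec
    have htop := last_dual_intersection_numbers_eq (N := X.card)
      (m := fun j => (diffTwo f j).eval 1) hn2 hs2 hm0 hm hb0 hsum hrec
      (by
        have := h.eval_diagonal_ne_zero ⟨s - 1, by omega⟩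
        rwa [hα0] at this)
      hN2 (fun _ => hm1)
      (fun h3 => by
        rw [hlast (s - 1) (by omega) (by omega), if_neg (by omega)]
        congr 3
        omega)
    refine ⟨fun hi hj => ?_, fun hi hj => ?_, fun hij hj => ?_, fun hj hij hjs => ?_,
      fun hi hj => ?_, fun hi hj => ?_⟩
    · rw [hb i j (by omega), hj, hb0]
    · rw [he i j (by omega), hj, hed]
    · rw [he i j hij, (hsphere j (by omega) hj).1]
    · rw [hb i j hij, (hsphere j hj hjs).2]
    · rw [he i j (by omega), show (j : ℕ) = s - 1 by omega, htop.1]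
    · rw [hb i j (by omega), show (j : ℕ) = s - 1 by omega, htop.2]
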